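/- Let $m,n\ge 0$ be integers, $r,h_0>0$ and $p\ge 1$ real. Let $A_{11}(z,h)\in\mathbb C^{m\times m}$, $A_{22}(z,h)\in\mathbb C^{n\times n}$ and $\Theta(z,h)\in\mathbb C^{(m+n)\times(m+n)}$ be analytic in $z$ and continuous in $h$ on $B(0,r)\times(0,h_0)\subset\mathbb C\times\mathbb R^+$, bounded on this set, and suppose that $A_{11}(0,h)$ and $A_{22}(0,h)$ have no eigenvalues in common, uniformly in $h$: there is $\delta>0$ such that $|a-b|\ge\delta$ for all $h\in(0,h_0)$, $a\in\sigma(A_{11}(0,h))$, $b\in\sigma(A_{22}(0,h))$. Consider the singular system $$ z h \frac{dW}{dz}=\begin{pmatrix}A_{11}&0\\0&A_{22}\end{pmatrix}(z,h)\,W+h^p\,\Theta(z,h)\,W. \qquad (*)$$ Then there are $\rho\in(0,r]$, $h_1\in(0,h_0]$, $C\in\mathbb R$ and, for every $h\in(0,h_1)$, a matrix function $T(\cdot,h)$, analytic and invertible on the slit disk $B(0,\rho)\setminus(-\infty,0]$, such that: - $T(\cdot,h)$ is a block-diagonalizing conjugator of $(*)$: there are analytic matrix functions $D_{11}(\cdot,h)$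 (of size $m\times m$) and $D_{22}(\cdot,h)$ (of size $n\times n$) on the slit disk such that, on every open subset of the slit disk, $Z$ is a solution of $zhZ'=\begin{pmatrix}D_{11}&0\\0&D_{22}\end{pmatrix}Z$ if and only if $W=TZ$ is a solution of $(*)$; - $|T(z,h)|\le C$, $|T(z,h)^{-1}|\le C$ and $|T(z,h)-\mathrm{Id}|\le C h^p$ for all $z$ in the slit disk and all $h\in(0,h_1)$, where $|\cdot|$ is the maximum of the moduli of the entries; - for every $h\in(0,h_1)$, $T(\cdot,h)$ is continuous at $z=0$, i.e. $T(z,h)$ has a limit as $z\to0$ in the slit disk. -/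

import Mathlib

open scoped Matrix

noncomputable section

/-- The open disk of radius `ρ` about `0`, slit along the closed negative real axis. -/
def slitBall (ρ : ℝ) : Set ℂ := Metric.ball 0 ρ ∩ Complex.slitPlane

/-- A matrix-valued function of a complex variable is analytic on (a neighbourhood of every
point of) `U`; this is meant entry by entry. -/
def MatAnalyticOn {ι : Type*} (M : ℂ → Matrix ι ι ℂ) (U : Set ℂ) : Prop :=
  ∀ i j, AnalyticOnNhd ℂ (fun z => M z i j) U

/-- `W` is a (holomorphic) solution on `U` of the system `z h W' = A(z) W`. -/
def IsSolutionOn {ι : Type*} [Fintype ι] (U : Set ℂ) (h : ℝ) (A : ℂ → Matrix ι ι ℂ)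
    (W : ℂ → ι → ℂ) : Prop :=
  ∀ z ∈ U, DifferentiableAt ℂ W z ∧ (z * (h : ℂ)) • deriv W z = A z *ᵥ W z

/-- The coefficient `diag(A₁₁, A₂₂)(z,h) + h^p Θ(z,h)`, as a function of `z`. -/
def fullCoeff {m n : Type*} (A₁₁ : ℂ → ℝ → Matrix m m ℂ) (A₂₂ : ℂ → ℝ → Matrix n n ℂ)
    (Θ : ℂ → ℝ → Matrix (m ⊕ n) (m ⊕ n) ℂ) (p h : ℝ) (z : ℂ) : Matrix (m ⊕ n) (m ⊕ n) ℂ :=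
  Matrix.fromBlocks (A₁₁ z h) 0 0 (A₂₂ z h) + ((h ^ p : ℝ) : ℂ) • Θ z h

/-- `T` is an analytic block-diagonalizing conjugator on `Ω` of the system `z h W' = A(z) W`:
it is analytic and invertible, and the change of variables `W = T Z` turns the system into a
block-diagonal system `z h Z' = diag(D₁₁, D₂₂)(z) Z` with analytic coefficients, that is, the
solutions of the one correspond to the solutions of the other on every open subset of `Ω`. -/
structure IsBlockDiagonalizingConjugator {m n : Type*} [Fintype m] [Fintype n]
    [DecidableEq m] [DecidableEq n] (Ω : Set ℂ) (h : ℝ)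
    (A : ℂ → Matrix (m ⊕ n) (m ⊕ n) ℂ) (T : ℂ → Matrix (m ⊕ n) (m ⊕ n) ℂ) : Prop where
  analytic : MatAnalyticOn T Ω
  isUnit : ∀ z ∈ Ω, IsUnit (T z)
  conjugates : ∃ (D₁₁ : ℂ → Matrix m m ℂ) (D₂₂ : ℂ → Matrix n n ℂ),
    MatAnalyticOn D₁₁ Ω ∧ MatAnalyticOn D₂₂ Ω ∧
    ∀ U : Set ℂ, IsOpen U → U ⊆ Ω → ∀ Z : ℂ → (m ⊕ n) → ℂ,
      (IsSolutionOn U h (fun z => Matrix.fromBlocks (D₁₁ z) 0 0 (D₂₂ z)) Z ↔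
        IsSolutionOn U h A (fun z => T z *ᵥ Z z))

end

/-! Put `η = h ^ p` and look for `T` with identity diagonal blocks and off-diagonal blocks `η x`, `η
y`. The equation `z h T' = A T - T D` with `D` block-diagonal fixes `D` and decouples into one
Riccati equation for `x` and one for `y`, of the same shape: `z h y' = B y - y A + P + η (Q y - y S)
- η² y U y`. What is needed is a solution bounded uniformly in `h` on a slit disk of fixed radius,
with a limit at `0` (`exists_riccati_solution`). Then `T - 1 = O(η)`, and `T` is invertible for
small `h`.

In the coordinate `z = ρ e^{-w}` one has `z d/dz = -d/dw`, and the origin becomes infinity in a cone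
around the positive real axis. The equation reads `-h y' = L y + F(w, y)`, where `L` is the
Sylvester operator `Y ↦ B(0) Y - Y A(0)`. Its eigenvalues are differences of eigenvalues of the two
blocks, hence of modulus at least `δ`. The Lipschitz constant of `F` in `y` is small when `ρ` and
`h` are. So a contraction argument suffices (`IsGreen.exists_solution`), once `-h y' = L y + f` has
a solution operator on bounded holomorphic functions whose norm does not depend on `h`.

For a scalar `l` such an operator integrates either from infinity along an edge of the cone or from
the vertex, according to the sign of `l.re - κ * |l.im|`; its norm is controlled as long as this
quantity stays away from `0` (`exists_isGreen_smul`). A pigeonhole argument finds a slope `κ`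
suitable for all eigenvalues at once (`exists_slope`). No diagonalization of `L` is used, as it
could not be uniform in `h`: scalar operators are chained along the roots of the characteristic
polynomial, and Cayley–Hamilton ends the chain (`exists_green_of_list`). The slope may vary with
`h`, but as `κ ≥ 1` every cone contains the image of the slit disk of radius `ρ e^{-π}`. -/

open Set Filter Topology MeasureTheory

noncomputable section

/-! ### Bounded holomorphic functions on cones -/

section GreenFunction

variable {E : Type*} [NormedAddCommGroup E] [NormedSpace ℂ E]

/-- A parametric integral of holomorphic functions dominated by an integrable function is
holomorphic, and may be differentiated under the integral sign. -/
theorem hasDerivAt_integral_of_hasDerivAt_ball {α : Type*} [MeasurableSpace α] {μ : Measure α}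
    {H H' : ℂ → α → E} {w₀ : ℂ} {ε : ℝ} (hε : 0 < ε) {b : α → ℝ} (hb : Integrable b μ)
    (hm : ∀ w ∈ Metric.ball w₀ ε, AEStronglyMeasurable (H w) μ)
    (hm' : AEStronglyMeasurable (H' w₀) μ)
    (hle : ∀ᵐ t ∂μ, ∀ w ∈ Metric.ball w₀ ε, ‖H w t‖ ≤ b t)
    (hd : ∀ᵐ t ∂μ, ∀ w ∈ Metric.ball w₀ ε, HasDerivAt (fun w => H w t) (H' w t) w) :
    Integrable (H' w₀) μ ∧ HasDerivAt (fun w => ∫ t, H w t ∂μ) (∫ t, H' w₀ t ∂μ) w₀ := by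
  have hw₀ : w₀ ∈ Metric.ball w₀ ε := Metric.mem_ball_self hε
  refine hasDerivAt_integral_of_dominated_loc_of_deriv_le (s := Metric.ball w₀ (ε / 2))
    (bound := fun t => b t / (ε / 4)) (Metric.ball_mem_nhds _ (by positivity)) ?_ ?_ hm' ?_
    (hb.div_const _) ?_
  · filter_upwards [Metric.ball_mem_nhds w₀ hε] with w hw using hm w hw
  · refine hb.mono' (hm _ hw₀) ?_
    filter_upwards [hle] with t ht using ht _ hw₀
  · filter_upwards [hle, hd] with t ht hdt w hw
    -- Cauchy's estimate on circles of radius `ε / 4`, which stay inside the ball when the centre is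
    -- within `ε / 2`, dominates the derivatives by `b t / (ε / 4)`.
    have hsub : Metric.closedBall w (ε / 4) ⊆ Metric.ball w₀ ε := by
      intro x hx
      rw [Metric.mem_closedBall] at hx
      rw [Metric.mem_ball] at hw ⊢
      linarith [dist_triangle x w w₀]
    rw [← (hdt w (hsub (Metric.mem_closedBall_self (by positivity)))).deriv]
    refine Complex.norm_deriv_le_of_forall_mem_sphere_norm_le (by positivity) ?_
      fun z hz => ht z (hsub (Metric.sphere_subset_closedBall hz))
    refine DifferentiableOn.diffContOnCl (s := Metric.ball w (ε / 4)) fun z hz => ?_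
    exact (hdt z (hsub (Metric.closure_ball_subset_closedBall hz))).differentiableAt.differentiableWithinAt
  · filter_upwards [hd] with t hdt w hw
    exact hdt w (Metric.ball_subset_ball (by linarith) hw)

/-- The open convex cone of slope `κ` around the positive real axis. -/
def cone (κ : ℝ) : Set ℂ := {w | |w.im| < κ * w.re}

theorem isOpen_cone (κ : ℝ) : IsOpen (cone κ) :=
  isOpen_lt (Complex.continuous_im.abs) (continuous_const.mul Complex.continuous_re)

theorem re_pos_of_mem_cone {κ : ℝ} (hκ : 0 < κ) {w : ℂ} (hw : w ∈ cone κ) : 0 < w.re := by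
  have h : |w.im| < κ * w.re := hw
  exact pos_of_mul_pos_right (lt_of_le_of_lt (abs_nonneg _) h) hκ.le

theorem norm_le_of_mem_cone {κ : ℝ} {w : ℂ} (hw : w ∈ cone κ) (hre : 0 ≤ w.re) :
    ‖w‖ ≤ (1 + κ) * w.re := by
  have h : |w.im| < κ * w.re := hw
  have h2 := Complex.norm_le_abs_re_add_abs_im w
  rw [abs_of_nonneg hre] at h2
  linarith

theorem smul_mem_cone {κ : ℝ} {w : ℂ} (hw : w ∈ cone κ) {t : ℝ} (ht : 0 < t) :
    (t : ℂ) * w ∈ cone κ := by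
  have h : |w.im| < κ * w.re := hw
  simp only [cone, mem_ofPred_eq, Complex.im_ofReal_mul, Complex.re_ofReal_mul, abs_mul,
    abs_of_pos ht]
  nlinarith

/-- The inequality on `ω` is not strict, because the rays of integration will be parallel to an edge
of the cone. -/
theorem add_mul_mem_cone {κ : ℝ} {w ω : ℂ} (hw : w ∈ cone κ) (hω : |ω.im| ≤ κ * ω.re)
    {t : ℝ} (ht : 0 ≤ t) : w + t * ω ∈ cone κ := by
  have h : |w.im| < κ * w.re := hw
  simp only [cone, mem_ofPred_eq, Complex.add_im, Complex.add_re, Complex.im_ofReal_mul,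
    Complex.re_ofReal_mul]
  calc |w.im + t * ω.im| ≤ |w.im| + t * |ω.im| := by
        refine (abs_add_le _ _).trans ?_
        rw [abs_mul, abs_of_nonneg ht]
    _ < κ * (w.re + t * ω.re) := by nlinarith

/-- The filter of points of the cone going to infinity. -/
def coneAtInf (κ : ℝ) : Filter ℂ := comap Complex.re atTop ⊓ 𝓟 (cone κ)

/-- Needed for dominated convergence along this filter. -/
instance (κ : ℝ) : (coneAtInf κ).IsCountablyGenerated := by
  unfold coneAtInf; infer_instance

theorem eventually_mem_cone (κ : ℝ) : ∀ᶠ w in coneAtInf κ, w ∈ cone κ :=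
  mem_inf_of_right (mem_principal_self _)

theorem tendsto_re_coneAtInf (κ : ℝ) : Tendsto Complex.re (coneAtInf κ) atTop :=
  tendsto_comap.mono_left inf_le_left

theorem tendsto_coneAtInf {α : Type*} {l : Filter α} {κ : ℝ} {g : α → ℂ}
    (h₁ : Tendsto (fun a => (g a).re) l atTop) (h₂ : ∀ᶠ a in l, g a ∈ cone κ) :
    Tendsto g l (coneAtInf κ) :=
  tendsto_inf.2 ⟨tendsto_comap_iff.2 h₁, tendsto_principal.2 h₂⟩

/-- Bounded holomorphic functions on a cone which have a limit at infinity. -/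
structure ConeAdm (κ : ℝ) (f : ℂ → E) : Prop where
  diff : DifferentiableOn ℂ f (cone κ)
  bdd : ∃ M, ∀ w ∈ cone κ, ‖f w‖ ≤ M
  lim : ∃ l, Tendsto f (coneAtInf κ) (𝓝 l)

theorem ConeAdm.hasDerivAt {κ : ℝ} {f : ℂ → E} (hf : ConeAdm κ f) {w : ℂ} (hw : w ∈ cone κ) :
    HasDerivAt f (deriv f w) w :=
  (hf.diff.differentiableAt ((isOpen_cone κ).mem_nhds hw)).hasDerivAt

theorem ConeAdm.continuousOn_deriv [CompleteSpace E] {κ : ℝ} {f : ℂ → E} (hf : ConeAdm κ f) :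
    ContinuousOn (deriv f) (cone κ) :=
  (hf.diff.deriv (isOpen_cone κ)).continuousOn

/-- The solution of `y' = -(μ y + f)` obtained by integrating from infinity in direction `ω`. -/
def rayInt (μ ω : ℂ) (f : ℂ → E) (w : ℂ) : E :=
  ω • ∫ s in Ioi (0 : ℝ), Complex.exp (s * (μ * ω)) • f (w + s * ω)

/-! ### Integration from infinity along a ray -/

section Ray

variable {κ c : ℝ} {μ ω : ℂ} {f : ℂ → E}

theorem norm_exp_ray_le (hμ : (μ * ω).re ≤ -c) {s : ℝ} (hs : 0 ≤ s) :
    ‖Complex.exp (s * (μ * ω))‖ ≤ Real.exp (-c * s) := by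
  rw [Complex.norm_exp, Complex.re_ofReal_mul]
  exact Real.exp_le_exp.2 (by nlinarith)

theorem continuousOn_ray (hf : ContinuousOn f (cone κ)) (hω : |ω.im| ≤ κ * ω.re) {w : ℂ}
    (hw : w ∈ cone κ) :
    ContinuousOn (fun s : ℝ => Complex.exp (s * (μ * ω)) • f (w + s * ω)) (Ici 0) := by
  refine ContinuousOn.smul (by fun_prop) (hf.comp (by fun_prop) fun s hs => ?_)
  exact add_mul_mem_cone hw hω hs

theorem aestronglyMeasurable_ray (hf : ContinuousOn f (cone κ)) (hω : |ω.im| ≤ κ * ω.re) {w : ℂ}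
    (hw : w ∈ cone κ) :
    AEStronglyMeasurable (fun s : ℝ => Complex.exp (s * (μ * ω)) • f (w + s * ω))
      (volume.restrict (Ioi 0)) :=
  ((continuousOn_ray hf hω hw).mono Ioi_subset_Ici_self).aestronglyMeasurable measurableSet_Ioi

theorem norm_ray_le {M : ℝ} (hM : ∀ w ∈ cone κ, ‖f w‖ ≤ M) (hω : |ω.im| ≤ κ * ω.re)
    (hμ : (μ * ω).re ≤ -c) {w : ℂ} (hw : w ∈ cone κ) {s : ℝ} (hs : 0 ≤ s) :
    ‖Complex.exp (s * (μ * ω)) • f (w + s * ω)‖ ≤ Real.exp (-c * s) * M := by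
  rw [norm_smul]
  exact mul_le_mul (norm_exp_ray_le hμ hs) (hM _ (add_mul_mem_cone hw hω hs)) (norm_nonneg _)
    (Real.exp_nonneg _)

theorem integrable_exp_mul_const (hc : 0 < c) (M : ℝ) :
    Integrable (fun s : ℝ => Real.exp (-c * s) * M) (volume.restrict (Ioi 0)) :=
  (integrableOn_exp_mul_Ioi (by linarith) 0).mul_const M

theorem integral_exp_mul_const (hc : 0 < c) (M : ℝ) :
    ∫ s in Ioi (0 : ℝ), Real.exp (-c * s) * M = M / c := by
  rw [integral_mul_const, integral_exp_mul_Ioi (by linarith)]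
  simp
  field_simp

theorem integrable_ray (hf : ContinuousOn f (cone κ)) {M : ℝ} (hM : ∀ w ∈ cone κ, ‖f w‖ ≤ M)
    (hc : 0 < c) (hω : |ω.im| ≤ κ * ω.re) (hμ : (μ * ω).re ≤ -c) {w : ℂ} (hw : w ∈ cone κ) :
    IntegrableOn (fun s : ℝ => Complex.exp (s * (μ * ω)) • f (w + s * ω)) (Ioi 0) := by
  refine (integrable_exp_mul_const hc M).mono' (aestronglyMeasurable_ray hf hω hw) ?_
  filter_upwards [ae_restrict_mem measurableSet_Ioi] with s hs
  exact norm_ray_le hM hω hμ hw (le_of_lt hs)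

theorem norm_rayInt_le {M : ℝ} (hM : ∀ w ∈ cone κ, ‖f w‖ ≤ M)
    (hc : 0 < c) (hω : |ω.im| ≤ κ * ω.re) (hμ : (μ * ω).re ≤ -c) {w : ℂ} (hw : w ∈ cone κ) :
    ‖rayInt μ ω f w‖ ≤ ‖ω‖ / c * M := by
  rw [rayInt, norm_smul, div_mul_eq_mul_div, mul_div_assoc]
  refine mul_le_mul_of_nonneg_left ?_ (norm_nonneg _)
  rw [← integral_exp_mul_const hc]
  refine norm_integral_le_of_norm_le (integrable_exp_mul_const hc M) ?_
  filter_upwards [ae_restrict_mem measurableSet_Ioi] with s hs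
  exact norm_ray_le hM hω hμ hw (le_of_lt hs)

theorem hasDerivAt_rayInt [CompleteSpace E] (hf : ConeAdm κ f) (hc : 0 < c)
    (hω : |ω.im| ≤ κ * ω.re) (hμ : (μ * ω).re ≤ -c) {w : ℂ} (hw : w ∈ cone κ) :
    HasDerivAt (rayInt μ ω f) (-(μ • rayInt μ ω f w + f w)) w := by
  obtain ⟨M, hM⟩ := hf.bdd
  obtain ⟨ε, hε, hball⟩ := Metric.isOpen_iff.1 (isOpen_cone κ) w hw
  have hcont := hf.diff.continuousOn
  obtain ⟨hint, hder⟩ := hasDerivAt_integral_of_hasDerivAt_ball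
    (μ := volume.restrict (Ioi (0 : ℝ)))
    (H := fun w s => Complex.exp (s * (μ * ω)) • f (w + s * ω))
    (H' := fun w s => Complex.exp (s * (μ * ω)) • deriv f (w + s * ω)) hε
    (integrable_exp_mul_const hc M)
    (fun v hv => aestronglyMeasurable_ray hcont hω (hball hv))
    (aestronglyMeasurable_ray hf.continuousOn_deriv hω hw)
    (by
      filter_upwards [ae_restrict_mem measurableSet_Ioi] with s hs v hv
      exact norm_ray_le hM hω hμ (hball hv) (le_of_lt hs))
    (by
      filter_upwards [ae_restrict_mem measurableSet_Ioi] with s hs v hv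
      exact ((hf.hasDerivAt (add_mul_mem_cone (hball hv) hω (le_of_lt hs))).comp_add_const v
        (s * ω)).const_smul _)
  have hI := integrable_ray hcont hM hc hω hμ hw
  have hi₁ : IntegrableOn
      (fun s : ℝ => ω • (Complex.exp (s * (μ * ω)) • deriv f (w + s * ω))) (Ioi 0) := hint.smul ω
  have hi₂ : IntegrableOn
      (fun s : ℝ => (μ * ω) • (Complex.exp (s * (μ * ω)) • f (w + s * ω))) (Ioi 0) :=
    hI.smul (μ * ω)
  -- The `s`-derivative of the integrand is `ω` times its `w`-derivative plus `μ * ω` times itself.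
  -- Integrating it leaves only the boundary term `-f w`, which is the differential equation.
  have hftc := integral_Ioi_of_hasDerivAt_of_tendsto (a := 0) (m := (0 : E))
    (f := fun s : ℝ => Complex.exp (s * (μ * ω)) • f (w + s * ω))
    (f' := fun s : ℝ => ω • (Complex.exp (s * (μ * ω)) • deriv f (w + s * ω)) +
      (μ * ω) • (Complex.exp (s * (μ * ω)) • f (w + s * ω)))
    ((continuousOn_ray hcont hω hw) 0 self_mem_Ici)
    (by
      intro s hs
      have h1 : HasDerivAt (fun s : ℝ => w + s * ω) ω s := by
        simpa using ((Complex.ofRealCLM.hasDerivAt (x := s)).mul_const ω).const_add w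
      have h2 := (hf.hasDerivAt (add_mul_mem_cone hw hω (le_of_lt hs))).scomp s h1
      have h3 : HasDerivAt (fun s : ℝ => Complex.exp (s * (μ * ω)))
          (Complex.exp (s * (μ * ω)) * (μ * ω)) s := by
        simpa using ((Complex.ofRealCLM.hasDerivAt (x := s)).mul_const (μ * ω)).cexp
      refine (h3.smul h2).congr_deriv ?_
      simp only [Function.comp_apply, smul_smul]
      congr 2 <;> ring)
    (hi₁.add hi₂)
    (by
      refine squeeze_zero_norm' (a := fun s => Real.exp (-c * s) * M) ?_ ?_
      · filter_upwards [eventually_ge_atTop 0] with s hs using norm_ray_le hM hω hμ hw hs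
      · have : Tendsto (fun s : ℝ => Real.exp (-c * s)) atTop (𝓝 0) :=
          Real.tendsto_exp_atBot.comp (tendsto_id.const_mul_atTop_of_neg (by linarith))
        simpa using this.mul_const M)
  rw [integral_add hi₁ hi₂, integral_smul, integral_smul] at hftc
  refine (hder.const_smul ω).congr_deriv ?_
  rw [rayInt, smul_smul, eq_sub_of_add_eq hftc]
  simp
  abel

/-- The direction `ω` is fixed, so every point `w + s * ω` goes to infinity in the cone with `w`,
and dominated convergence gives the limit. -/
theorem ConeAdm.rayInt [CompleteSpace E] (hf : ConeAdm κ f) (hc : 0 < c)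
    (hω : |ω.im| ≤ κ * ω.re) (hμ : (μ * ω).re ≤ -c) :
    ConeAdm κ (rayInt μ ω f) := by
  obtain ⟨M, hM⟩ := hf.bdd
  obtain ⟨l, hl⟩ := hf.lim
  refine ⟨fun w hw =>
      (hasDerivAt_rayInt hf hc hω hμ hw).differentiableAt.differentiableWithinAt,
    ⟨_, fun w hw => norm_rayInt_le hM hc hω hμ hw⟩,
    ω • ∫ s in Ioi (0 : ℝ), Complex.exp (s * (μ * ω)) • l, ?_⟩
  refine Tendsto.const_smul ?_ ω
  refine tendsto_integral_filter_of_dominated_convergence (fun s => Real.exp (-c * s) * M)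
    ?_ ?_ (integrable_exp_mul_const hc M) ?_
  · filter_upwards [eventually_mem_cone κ] with w hw
    exact aestronglyMeasurable_ray hf.diff.continuousOn hω hw
  · filter_upwards [eventually_mem_cone κ] with w hw
    filter_upwards [ae_restrict_mem measurableSet_Ioi] with s hs
    exact norm_ray_le hM hω hμ hw (le_of_lt hs)
  · filter_upwards [ae_restrict_mem measurableSet_Ioi] with s hs
    refine (hl.comp (tendsto_coneAtInf ?_ ?_)).const_smul _
    · simp only [Complex.add_re, Complex.re_ofReal_mul]
      exact tendsto_atTop_add_const_right _ _ (tendsto_re_coneAtInf κ)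
    · filter_upwards [eventually_mem_cone κ] with w hw
      exact add_mul_mem_cone hw hω (le_of_lt hs)

end Ray

/-- The solution of `y' = -(μ y + f)` obtained by integrating from the vertex of the cone. -/
def vertexInt (μ : ℂ) (f : ℂ → E) (w : ℂ) : E :=
  -(w • ∫ t in Ioo (0 : ℝ) 1, Complex.exp (-(t * (μ * w))) • f (((1 - t : ℝ) : ℂ) * w))

/-! ### Integration from the vertex of the cone -/

section Vertex

variable {κ c : ℝ} {μ : ℂ} {f : ℂ → E}

theorem continuousOn_vertex (hf : ContinuousOn f (cone κ)) {w : ℂ} (hw : w ∈ cone κ) :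
    ContinuousOn (fun t : ℝ => Complex.exp (-(t * (μ * w))) • f (((1 - t : ℝ) : ℂ) * w))
      (Iio 1) := by
  refine ContinuousOn.smul (by fun_prop) (hf.comp (by fun_prop) fun t ht => ?_)
  exact smul_mem_cone hw (sub_pos.2 ht)

theorem aestronglyMeasurable_vertex (hf : ContinuousOn f (cone κ)) {w : ℂ} (hw : w ∈ cone κ) :
    AEStronglyMeasurable
      (fun t : ℝ => Complex.exp (-(t * (μ * w))) • f (((1 - t : ℝ) : ℂ) * w))
      (volume.restrict (Ioo 0 1)) :=
  ((continuousOn_vertex hf hw).mono fun _ ht => ht.2).aestronglyMeasurable measurableSet_Ioo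

theorem norm_vertex_le {M : ℝ} (hM : ∀ w ∈ cone κ, ‖f w‖ ≤ M)
    (hμ : ∀ w ∈ cone κ, c * w.re ≤ (μ * w).re) {w : ℂ} (hw : w ∈ cone κ) {t : ℝ}
    (ht : t ∈ Ico (0 : ℝ) 1) :
    ‖Complex.exp (-(t * (μ * w))) • f (((1 - t : ℝ) : ℂ) * w)‖
      ≤ Real.exp (-(c * w.re) * t) * M := by
  rw [norm_smul, Complex.norm_exp, Complex.neg_re, Complex.re_ofReal_mul]
  refine mul_le_mul (Real.exp_le_exp.2 ?_) (hM _ (smul_mem_cone hw (sub_pos.2 ht.2)))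
    (norm_nonneg _) (Real.exp_nonneg _)
  have := mul_le_mul_of_nonneg_left (hμ w hw) ht.1
  linarith

theorem integrable_vertex (hf : ContinuousOn f (cone κ)) {M : ℝ} (hM : ∀ w ∈ cone κ, ‖f w‖ ≤ M)
    (hκ : 0 < κ) (hc : 0 < c) (hμ : ∀ w ∈ cone κ, c * w.re ≤ (μ * w).re) {w : ℂ}
    (hw : w ∈ cone κ) :
    IntegrableOn (fun t : ℝ => Complex.exp (-(t * (μ * w))) • f (((1 - t : ℝ) : ℂ) * w))
      (Ioo 0 1) := by
  refine ((integrable_exp_mul_const (mul_pos hc (re_pos_of_mem_cone hκ hw)) M).mono_measure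
    (Measure.restrict_mono Ioo_subset_Ioi_self le_rfl)).mono' (aestronglyMeasurable_vertex hf hw) ?_
  filter_upwards [ae_restrict_mem measurableSet_Ioo] with t ht using
    norm_vertex_le hM hμ hw (Ioo_subset_Ico_self ht)

/-- The exponential integrates to at most `1 / (c * w.re)`, and the prefactor `‖w‖ ≤ (1 + κ) * w.re`
compensates this. -/
theorem norm_vertexInt_le {M : ℝ} (hM : ∀ w ∈ cone κ, ‖f w‖ ≤ M)
    (hκ : 0 < κ) (hc : 0 < c) (hμ : ∀ w ∈ cone κ, c * w.re ≤ (μ * w).re) {w : ℂ}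
    (hw : w ∈ cone κ) :
    ‖vertexInt μ f w‖ ≤ (1 + κ) / c * M := by
  have hre := re_pos_of_mem_cone hκ hw
  have hM0 : 0 ≤ M := (norm_nonneg _).trans (hM w hw)
  have hint := integrable_exp_mul_const (mul_pos hc hre) M
  have h : ‖∫ t in Ioo (0 : ℝ) 1, Complex.exp (-(t * (μ * w))) • f (((1 - t : ℝ) : ℂ) * w)‖
      ≤ M / (c * w.re) := by
    rw [← integral_exp_mul_const (mul_pos hc hre)]
    refine (norm_integral_le_of_norm_le (hint.mono_measure
      (Measure.restrict_mono Ioo_subset_Ioi_self le_rfl)) ?_).trans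
      (setIntegral_mono_set hint (ae_of_all _ fun t => by positivity)
        (LE.le.eventuallyLE Ioo_subset_Ioi_self))
    filter_upwards [ae_restrict_mem measurableSet_Ioo] with t ht using
    norm_vertex_le hM hμ hw (Ioo_subset_Ico_self ht)
  rw [vertexInt, norm_neg, norm_smul]
  calc ‖w‖ * _ ≤ ((1 + κ) * w.re) * (M / (c * w.re)) :=
        mul_le_mul (norm_le_of_mem_cone hw hre.le) h (norm_nonneg _) (by positivity)
    _ = (1 + κ) / c * M := by field_simp

theorem hasDerivAt_vertexInt [CompleteSpace E] (hf : ConeAdm κ f) (hκ : 0 < κ) (hc : 0 < c)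
    (hμ : ∀ w ∈ cone κ, c * w.re ≤ (μ * w).re) {w : ℂ} (hw : w ∈ cone κ) :
    HasDerivAt (vertexInt μ f) (-(μ • vertexInt μ f w + f w)) w := by
  obtain ⟨M, hM⟩ := hf.bdd
  have hM0 : 0 ≤ M := (norm_nonneg _).trans (hM w hw)
  obtain ⟨ε, hε, hball⟩ := Metric.isOpen_iff.1 (isOpen_cone κ) w hw
  have hcont := hf.diff.continuousOn
  obtain ⟨hint, hder⟩ := hasDerivAt_integral_of_hasDerivAt_ball
    (μ := volume.restrict (Ioo (0 : ℝ) 1))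
    (H := fun w t => Complex.exp (-(t * (μ * w))) • f (((1 - t : ℝ) : ℂ) * w))
    (H' := fun w t => ((1 - t : ℝ) : ℂ) •
        (Complex.exp (-(t * (μ * w))) • deriv f (((1 - t : ℝ) : ℂ) * w)) +
      (-(t * μ)) • (Complex.exp (-(t * (μ * w))) • f (((1 - t : ℝ) : ℂ) * w))) hε
    (b := fun _ => M) (integrable_const _)
    (fun v hv => aestronglyMeasurable_vertex hcont (hball hv))
    (by
      refine AEStronglyMeasurable.add ?_ ?_
      · exact (Continuous.aestronglyMeasurable (by fun_prop)).smul
          (aestronglyMeasurable_vertex hf.continuousOn_deriv hw)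
      · exact (Continuous.aestronglyMeasurable (by fun_prop)).smul
          (aestronglyMeasurable_vertex hcont hw))
    (by
      filter_upwards [ae_restrict_mem measurableSet_Ioo] with t ht v hv
      refine (norm_vertex_le hM hμ (hball hv) (Ioo_subset_Ico_self ht)).trans ?_
      refine mul_le_of_le_one_left hM0 (Real.exp_le_one_iff.2 ?_)
      have := mul_pos (mul_pos hc (re_pos_of_mem_cone hκ (hball hv))) ht.1
      linarith)
    (by
      filter_upwards [ae_restrict_mem measurableSet_Ioo] with t ht v hv
      have h2 := (hf.hasDerivAt (smul_mem_cone (hball hv) (sub_pos.2 ht.2))).scomp v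
        ((hasDerivAt_id v).const_mul ((1 - t : ℝ) : ℂ))
      have h3 := (((hasDerivAt_id v).const_mul μ).const_mul (t : ℂ)).fun_neg.cexp
      refine (h3.smul h2).congr_deriv ?_
      simp only [Function.comp_apply, smul_smul, id]
      congr 2 <;> ring)
  have hI := integrable_vertex hcont hM hκ hc hμ hw
  set F : ℝ → E := fun t => Complex.exp (-(t * (μ * w))) • f (((1 - t : ℝ) : ℂ) * w) with hF
  set F' : ℝ → E := fun t => ((1 - t : ℝ) : ℂ) •
        (Complex.exp (-(t * (μ * w))) • deriv f (((1 - t : ℝ) : ℂ) * w)) +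
      (-(t * μ)) • (Complex.exp (-(t * (μ * w))) • f (((1 - t : ℝ) : ℂ) * w)) with hF'
  have hi₁ : IntegrableOn (fun t => -w • F' t) (Ioo 0 1) := hint.smul (-w)
  have hi₂ : IntegrableOn (fun t => -(μ * w) • F t) (Ioo 0 1) := hI.smul (-(μ * w))
  have hi₃ : IntegrableOn (fun t => -F t) (Ioo 0 1) := hI.neg
  have hi₄ : IntegrableOn (fun t => -w • F' t + -(μ * w) • F t) (Ioo 0 1) := hi₁.add hi₂
  have hint2 : IntegrableOn (fun t => -F t + (-w • F' t + -(μ * w) • F t)) (Ioo 0 1) :=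
    hi₃.add hi₄
  -- Differentiation under the integral produces `w • F'`. The weight `1 - t` makes the
  -- `t`-derivative of `(1 - t) • F t` a combination of `F` and `F'`, so that `f'` can be
  -- eliminated.
  have hftc := intervalIntegral.integral_eq_sub_of_hasDerivAt_of_le (a := 0) (b := 1)
    (f := fun t : ℝ => ((1 - t : ℝ) : ℂ) • F t)
    (f' := fun t : ℝ => -F t + (-w • F' t + -(μ * w) • F t))
    zero_le_one
    (by
      intro t ht
      rcases ht.2.lt_or_eq with h1 | rfl
      · refine ContinuousAt.continuousWithinAt (ContinuousAt.smul (by fun_prop) ?_)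
        exact (continuousOn_vertex hcont hw).continuousAt (Iio_mem_nhds h1)
      -- At `t = 1` the argument of `f` is the vertex, outside the cone, where nothing is known
      -- about `f`. Boundedness and the weight `1 - t` give continuity there.
      · have h0 : Tendsto (fun t : ℝ => (1 - t) * M) (𝓝[Icc 0 1] 1) (𝓝 ((1 - 1) * M)) :=
          (Continuous.tendsto (by fun_prop) 1).mono_left nhdsWithin_le_nhds
        rw [sub_self, zero_mul] at h0
        unfold ContinuousWithinAt
        simp only [sub_self, Complex.ofReal_zero, zero_smul]
        refine squeeze_zero_norm' ?_ h0
        filter_upwards [self_mem_nhdsWithin] with t ht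
        rw [norm_smul, Complex.norm_real, Real.norm_of_nonneg (sub_nonneg.2 ht.2)]
        rcases ht.2.lt_or_eq with h1 | rfl
        · refine mul_le_mul_of_nonneg_left ((norm_vertex_le hM hμ hw ⟨ht.1, h1⟩).trans ?_)
            (sub_nonneg.2 ht.2)
          refine mul_le_of_le_one_left hM0 (Real.exp_le_one_iff.2 ?_)
          have := mul_nonneg (mul_pos hc (re_pos_of_mem_cone hκ hw)).le ht.1
          linarith
        · simp)
    (by
      intro t ht
      have h0 : HasDerivAt (fun t : ℝ => ((1 - t : ℝ) : ℂ)) (-1) t := by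
        simpa using ((hasDerivAt_id t).const_sub 1).ofReal_comp
      have h2 := (hf.hasDerivAt (smul_mem_cone hw (sub_pos.2 ht.2))).scomp t (h0.mul_const w)
      have h3 : HasDerivAt (fun s : ℝ => Complex.exp (-(s * (μ * w))))
          (Complex.exp (-(t * (μ * w))) * -(μ * w)) t := by
        simpa using (((Complex.ofRealCLM.hasDerivAt (x := t)).mul_const (μ * w)).fun_neg).cexp
      refine (h0.smul (h3.smul h2)).congr_deriv ?_
      simp only [hF, hF', Pi.smul_apply', Function.comp_apply, smul_smul, smul_add]
      push_cast
      module)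
    ((intervalIntegrable_iff_integrableOn_Ioo_of_le zero_le_one).2 hint2)
  rw [intervalIntegral.integral_of_le zero_le_one, integral_Ioc_eq_integral_Ioo,
    integral_add hi₃ hi₄, integral_add hi₁ hi₂, integral_neg,
    integral_smul, integral_smul] at hftc
  refine (((hasDerivAt_id w).smul hder).neg).congr_deriv ?_
  have h4 : (fun t : ℝ => ((1 - t : ℝ) : ℂ) • F t) 1 - (fun t : ℝ => ((1 - t : ℝ) : ℂ) • F t) 0
      = - f w := by simp [hF]
  rw [h4] at hftc
  rw [vertexInt]
  rw [← neg_eq_iff_eq_neg] at hftc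
  rw [← hftc]
  simp only [id]
  module

/-- The rescaling `s = t * w.re` makes the exponential decay in `s` independent of the size of `w`,
as dominated convergence requires. -/
theorem vertexInt_eq_integral_Ioi {w : ℂ} (hw : 0 < w.re) :
    vertexInt μ f w = -((w / w.re) • ∫ s in Ioi (0 : ℝ), (Iio w.re).indicator
      (fun s => Complex.exp (-(s * (μ * (w / w.re)))) • f (((1 - s / w.re : ℝ) : ℂ) * w)) s) := by
  have hu : (w.re : ℂ) ≠ 0 := Complex.ofReal_ne_zero.2 hw.ne'
  have h := integral_comp_mul_left_Ioi (fun s => (Iio w.re).indicator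
      (fun s : ℝ => Complex.exp (-(s * (μ * (w / w.re)))) • f (((1 - s / w.re : ℝ) : ℂ) * w)) s)
      0 hw
  rw [mul_zero] at h
  have h2 : (∫ t in Ioo (0 : ℝ) 1, Complex.exp (-(t * (μ * w))) • f (((1 - t : ℝ) : ℂ) * w)) =
      ∫ t in Ioi (0 : ℝ), (Iio w.re).indicator
      (fun s : ℝ => Complex.exp (-(s * (μ * (w / w.re)))) • f (((1 - s / w.re : ℝ) : ℂ) * w))
        (w.re * t) := by
    rw [← Ioi_inter_Iio, ← setIntegral_indicator measurableSet_Iio]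
    refine setIntegral_congr_fun measurableSet_Ioi fun t _ => ?_
    simp only [indicator, mem_Iio, mul_lt_iff_lt_one_right hw]
    refine if_congr Iff.rfl ?_ rfl
    congr 2
    · congr 1
      push_cast
      field_simp
    · rw [mul_div_cancel_left₀ _ hw.ne']
  rw [vertexInt, h2, h, ← Complex.coe_smul, smul_smul, Complex.ofReal_inv, div_eq_mul_inv]

/-- The direction `w / w.re` stays bounded but need not converge, so the integrand has no pointwise
limit. It is compared with the same exponential times `l`, whose integral is explicit; the factor `w
/ w.re` then cancels. -/
theorem tendsto_vertexInt (hf : ConeAdm κ f) {l : E}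
    (hl : Tendsto f (coneAtInf κ) (𝓝 l)) (hκ : 0 < κ) (hc : 0 < c)
    (hμ : ∀ w ∈ cone κ, c * w.re ≤ (μ * w).re) [CompleteSpace E] :
    Tendsto (vertexInt μ f) (coneAtInf κ) (𝓝 (-(μ⁻¹ • l))) := by
  obtain ⟨M, hM⟩ := hf.bdd
  have hμ' : ∀ w ∈ cone κ, c ≤ (μ * (w / w.re)).re := by
    intro w hw
    have h := re_pos_of_mem_cone hκ hw
    rw [mul_div_assoc', Complex.div_ofReal_re, le_div_iff₀ h]
    exact hμ w hw
  have hexp : ∀ w ∈ cone κ, ∀ s : ℝ, 0 < s →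
      ‖Complex.exp (-(s * (μ * (w / w.re))))‖ ≤ Real.exp (-c * s) := by
    intro w hw s hs
    rw [Complex.norm_exp, Complex.neg_re, Complex.re_ofReal_mul]
    refine Real.exp_le_exp.2 ?_
    nlinarith [hμ' w hw]
  have hcexp : ∀ w ∈ cone κ, IntegrableOn
      (fun s : ℝ => Complex.exp (-(s * (μ * (w / w.re)))) • l) (Ioi 0) := by
    intro w hw
    refine (integrable_exp_mul_const hc ‖l‖).mono'
      (Continuous.aestronglyMeasurable (by fun_prop)) ?_
    filter_upwards [ae_restrict_mem measurableSet_Ioi] with s hs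
    rw [norm_smul]
    exact mul_le_mul_of_nonneg_right (hexp w hw s hs) (norm_nonneg _)
  set I : ℂ → ℝ → E := fun w s => (Iio w.re).indicator
      (fun s => Complex.exp (-(s * (μ * (w / w.re)))) • f (((1 - s / w.re : ℝ) : ℂ) * w)) s with hI
  have hmem : ∀ w ∈ cone κ, ∀ s : ℝ, s < w.re → ((1 - s / w.re : ℝ) : ℂ) * w ∈ cone κ := by
    intro w hw s hs
    refine smul_mem_cone hw (sub_pos.2 ?_)
    rwa [div_lt_one (re_pos_of_mem_cone hκ hw)]
  have hImeas : ∀ w ∈ cone κ, AEStronglyMeasurable (I w) (volume.restrict (Ioi 0)) := by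
    intro w hw
    rw [hI, aestronglyMeasurable_indicator_iff measurableSet_Iio]
    rw [Measure.restrict_restrict measurableSet_Iio]
    refine AEStronglyMeasurable.mono_measure (μ := volume.restrict (Iio w.re)) ?_
      (Measure.restrict_mono inter_subset_left le_rfl)
    refine ContinuousOn.aestronglyMeasurable ?_ measurableSet_Iio
    exact ContinuousOn.smul (by fun_prop)
      (hf.diff.continuousOn.comp (by fun_prop) fun s hs => hmem w hw s hs)
  have hIle : ∀ w ∈ cone κ, ∀ s : ℝ, 0 < s → ‖I w s‖ ≤ Real.exp (-c * s) * M := by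
    intro w hw s hs
    have hM0 : 0 ≤ M := (norm_nonneg _).trans (hM w hw)
    simp only [hI, indicator]
    split_ifs with h
    · rw [norm_smul]
      exact mul_le_mul (hexp w hw s hs) (hM _ (hmem w hw s h)) (norm_nonneg _)
        (Real.exp_nonneg _)
    · rw [norm_zero]; positivity
  have hIint : ∀ w ∈ cone κ, IntegrableOn (I w) (Ioi 0) := by
    intro w hw
    refine (integrable_exp_mul_const hc M).mono' (hImeas w hw) ?_
    filter_upwards [ae_restrict_mem measurableSet_Ioi] with s hs using hIle w hw s hs
  have hkey : Tendsto (fun w => ∫ s in Ioi (0 : ℝ),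
      (Complex.exp (-(s * (μ * (w / w.re)))) • l - I w s)) (coneAtInf κ) (𝓝 0) := by
    have := tendsto_integral_filter_of_dominated_convergence (l := coneAtInf κ)
      (μ := volume.restrict (Ioi (0 : ℝ))) (f := fun _ => (0 : E))
      (F := fun w s => Complex.exp (-(s * (μ * (w / w.re)))) • l - I w s)
      (fun s => Real.exp (-c * s) * (‖l‖ + M)) ?_ ?_ (integrable_exp_mul_const hc _) ?_
    · simpa using this
    · filter_upwards [eventually_mem_cone κ] with w hw
      exact (hcexp w hw).aestronglyMeasurable.sub (hImeas w hw)
    · filter_upwards [eventually_mem_cone κ] with w hw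
      filter_upwards [ae_restrict_mem measurableSet_Ioi] with s hs
      refine (norm_sub_le _ _).trans ?_
      rw [mul_add]
      refine add_le_add ?_ (hIle w hw s hs)
      rw [norm_smul]
      exact mul_le_mul_of_nonneg_right (hexp w hw s hs) (norm_nonneg _)
    · filter_upwards [ae_restrict_mem measurableSet_Ioi] with s hs
      have hlim : Tendsto (fun w : ℂ => f (((1 - s / w.re : ℝ) : ℂ) * w)) (coneAtInf κ) (𝓝 l) := by
        refine hl.comp (tendsto_coneAtInf ?_ ?_)
        · refine (tendsto_atTop_add_const_right _ (-s) (tendsto_re_coneAtInf κ)).congr' ?_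
          filter_upwards [eventually_mem_cone κ] with w hw
          have := (re_pos_of_mem_cone hκ hw).ne'
          rw [Complex.re_ofReal_mul]
          field_simp
          ring
        · filter_upwards [eventually_mem_cone κ,
            (tendsto_re_coneAtInf κ).eventually_gt_atTop s] with w hw hsw using hmem w hw s hsw
      refine squeeze_zero_norm' (a := fun w : ℂ => ‖l - f (((1 - s / w.re : ℝ) : ℂ) * w)‖) ?_ ?_
      · filter_upwards [eventually_mem_cone κ,
          (tendsto_re_coneAtInf κ).eventually_gt_atTop s] with w hw hsw
        rw [hI]
        simp only [indicator, mem_Iio, hsw, if_true]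
        rw [← smul_sub, norm_smul]
        refine mul_le_of_le_one_left (norm_nonneg _) ((hexp w hw s hs).trans ?_)
        refine Real.exp_le_one_iff.2 ?_
        have := mul_pos hc hs
        linarith
      · simpa using (hlim.const_sub l).norm
  have hzero : Tendsto (fun w : ℂ => (w / w.re) • ∫ s in Ioi (0 : ℝ),
      (Complex.exp (-(s * (μ * (w / w.re)))) • l - I w s)) (coneAtInf κ) (𝓝 0) := by
    refine squeeze_zero_norm' (a := fun w : ℂ => (1 + κ) * ‖∫ s in Ioi (0 : ℝ),
      (Complex.exp (-(s * (μ * (w / w.re)))) • l - I w s)‖) ?_ ?_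
    · filter_upwards [eventually_mem_cone κ] with w hw
      have h := re_pos_of_mem_cone hκ hw
      rw [norm_smul]
      refine mul_le_mul_of_nonneg_right ?_ (norm_nonneg _)
      rw [norm_div, Complex.norm_real, Real.norm_of_nonneg h.le, div_le_iff₀ h]
      exact norm_le_of_mem_cone hw h.le
    · simpa using hkey.norm.const_mul (1 + κ)
  have hfin := hzero.add_const (-(μ⁻¹ • l))
  rw [zero_add] at hfin
  refine hfin.congr' ?_
  filter_upwards [eventually_mem_cone κ] with w hw
  have h := re_pos_of_mem_cone hκ hw
  have hw0 : w / w.re ≠ 0 := by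
    refine div_ne_zero (fun h0 => ?_) (Complex.ofReal_ne_zero.2 h.ne')
    simp [h0] at h
  have hμ0 : μ ≠ 0 := by
    rintro rfl
    have := hμ' w hw
    simp at this
    linarith
  rw [integral_sub (hcexp w hw) (hIint w hw), integral_smul_const]
  have hexpint : ∫ s in Ioi (0 : ℝ), Complex.exp (-(s * (μ * (w / w.re)))) =
      (μ * (w / w.re))⁻¹ := by
    have := integral_exp_mul_complex_Ioi (a := -(μ * (w / w.re)))
      (by rw [Complex.neg_re]; linarith [hμ' w hw]) 0
    simp only [Complex.ofReal_zero, mul_zero, Complex.exp_zero, neg_div_neg_eq, one_div] at this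
    rw [← this]
    congr 1
    ext s
    congr 1
    ring
  rw [hexpint, vertexInt_eq_integral_Ioi h, smul_sub, smul_smul, mul_inv,
    mul_comm μ⁻¹, mul_inv_cancel_left₀ hw0]
  abel

theorem ConeAdm.vertexInt [CompleteSpace E] (hf : ConeAdm κ f) (hκ : 0 < κ) (hc : 0 < c)
    (hμ : ∀ w ∈ cone κ, c * w.re ≤ (μ * w).re) : ConeAdm κ (vertexInt μ f) := by
  obtain ⟨M, hM⟩ := hf.bdd
  obtain ⟨l, hl⟩ := hf.lim
  exact ⟨fun w hw =>
      (hasDerivAt_vertexInt hf hκ hc hμ hw).differentiableAt.differentiableWithinAt,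
    ⟨_, fun w hw => norm_vertexInt_le hM hκ hc hμ hw⟩, _, tendsto_vertexInt hf hl hκ hc hμ⟩

end Vertex

/-! ### Stability of the admissible class and scalar Green operators -/

theorem ConeAdm.const_smul {κ : ℝ} {f : ℂ → E} (hf : ConeAdm κ f) (a : ℂ) :
    ConeAdm κ (fun w => a • f w) := by
  obtain ⟨M, hM⟩ := hf.bdd
  obtain ⟨l, hl⟩ := hf.lim
  refine ⟨hf.diff.const_smul a, ⟨‖a‖ * M, fun w hw => ?_⟩, _, hl.const_smul a⟩
  rw [norm_smul]
  exact mul_le_mul_of_nonneg_left (hM w hw) (norm_nonneg _)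

theorem ConeAdm.add {κ : ℝ} {f g : ℂ → E} (hf : ConeAdm κ f) (hg : ConeAdm κ g) :
    ConeAdm κ (fun w => f w + g w) := by
  obtain ⟨M, hM⟩ := hf.bdd
  obtain ⟨l, hl⟩ := hf.lim
  obtain ⟨M', hM'⟩ := hg.bdd
  obtain ⟨l', hl'⟩ := hg.lim
  exact ⟨hf.diff.add hg.diff, ⟨M + M', fun w hw =>
    (norm_add_le _ _).trans (add_le_add (hM w hw) (hM' w hw))⟩, _, hl.add hl'⟩

theorem ConeAdm.sub {κ : ℝ} {f g : ℂ → E} (hf : ConeAdm κ f) (hg : ConeAdm κ g) :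
    ConeAdm κ (fun w => f w - g w) := by
  simpa [sub_eq_add_neg] using hf.add (hg.const_smul (-1))

theorem ConeAdm.clm_comp {κ : ℝ} {f : ℂ → E} (hf : ConeAdm κ f) (A : E →L[ℂ] E) :
    ConeAdm κ (fun w => A (f w)) := by
  obtain ⟨M, hM⟩ := hf.bdd
  obtain ⟨l, hl⟩ := hf.lim
  exact ⟨A.differentiable.comp_differentiableOn hf.diff, ⟨‖A‖ * M, fun w hw =>
    A.le_opNorm_of_le (hM w hw)⟩, _, (A.continuous.tendsto l).comp hl⟩

theorem ConeAdm.const (κ : ℝ) (x : E) : ConeAdm κ (fun _ => x) :=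
  ⟨differentiableOn_const x, ⟨‖x‖, fun _ _ => le_rfl⟩, x, tendsto_const_nhds⟩

/-- `G` is a linear operator solving `-h y' = L y + f` on the cone, with norm at most `Γ`. -/
structure IsGreen (κ h : ℝ) (L : E → E) (Γ : ℝ) (G : (ℂ → E) → ℂ → E) : Prop where
  adm : ∀ f, ConeAdm κ f → ConeAdm κ (G f)
  deriv : ∀ f, ConeAdm κ f → ∀ w ∈ cone κ,
    HasDerivAt (G f) (-((h : ℂ)⁻¹ • (L (G f w) + f w))) w
  bound : ∀ f, ConeAdm κ f → ∀ M, (∀ w ∈ cone κ, ‖f w‖ ≤ M) → ∀ w ∈ cone κ, ‖G f w‖ ≤ Γ * M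
  sub : ∀ f g, ConeAdm κ f → ConeAdm κ g → ∀ w ∈ cone κ,
    G (fun v => f v - g v) w = G f w - G g w

/-- The number `l.re - κ * |l.im|` is the smallest value of `(l * ω).re` over directions `ω` of the
closed cone with real part `1`. If it is negative, the exponential decays along the minimizing edge;
if it is positive, it has the right sign on the whole cone for integration from the vertex. The last
clause, compatibility with operators that annihilate `f`, is what allows chaining. -/
theorem exists_isGreen_smul [CompleteSpace E] {κ c h : ℝ} (hκ : 0 < κ) (hc : 0 < c) (hh : 0 < h)
    {l : ℂ} (hl : c ≤ abs (l.re - κ * |l.im|)) :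
    ∃ G : (ℂ → E) → ℂ → E, IsGreen κ h (fun x => l • x) ((1 + κ) / c) G ∧
      ∀ f, ConeAdm κ f → ∀ A : E →L[ℂ] E, (∀ w ∈ cone κ, A (f w) = 0) →
        ∀ w ∈ cone κ, A (G f w) = 0 := by
  have hh' : (h : ℂ) ≠ 0 := Complex.ofReal_ne_zero.2 hh.ne'
  have hch : 0 < c / h := div_pos hc hh
  have hnorm : ∀ f : ℂ → E, ∀ M, (∀ w ∈ cone κ, ‖f w‖ ≤ M) → ∀ w ∈ cone κ,
      ‖(h : ℂ)⁻¹ • f w‖ ≤ h⁻¹ * M := by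
    intro f M hM w hw
    rw [norm_smul, norm_inv, Complex.norm_real, Real.norm_of_nonneg hh.le]
    exact mul_le_mul_of_nonneg_left (hM w hw) (by positivity)
  rcases le_abs'.1 hl with hneg | hpos
  · obtain ⟨ω, hre, him, hlω⟩ : ∃ ω : ℂ, ω.re = 1 ∧ |ω.im| = κ ∧ (l * ω).re ≤ -c := by
      rcases le_total 0 l.im with hi | hi
      · refine ⟨⟨1, κ⟩, rfl, abs_of_pos hκ, ?_⟩
        rw [abs_of_nonneg hi] at hneg
        simp only [Complex.mul_re]
        linarith
      · refine ⟨⟨1, -κ⟩, rfl, by simp [abs_of_pos hκ], ?_⟩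
        rw [abs_of_nonpos hi] at hneg
        simp only [Complex.mul_re]
        linarith
    have hω : |ω.im| ≤ κ * ω.re := by rw [hre, him, mul_one]
    have hωn : ‖ω‖ ≤ 1 + κ := by
      refine (Complex.norm_le_abs_re_add_abs_im ω).trans ?_
      rw [hre, him, abs_one]
    have hμ : (l / h * ω).re ≤ -(c / h) := by
      rw [div_mul_eq_mul_div, Complex.div_ofReal_re, ← neg_div]
      exact div_le_div_of_nonneg_right hlω hh.le
    refine ⟨fun f => rayInt (l / h) ω (fun w => (h : ℂ)⁻¹ • f w), ⟨?_, ?_, ?_, ?_⟩, ?_⟩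
    · exact fun f hf => (hf.const_smul _).rayInt hch hω hμ
    · intro f hf w hw
      refine (hasDerivAt_rayInt (hf.const_smul _) hch hω hμ hw).congr_deriv ?_
      simp only [smul_add, smul_smul]
      rw [div_eq_inv_mul]
    · intro f hf M hM w hw
      have hM0 : 0 ≤ M := (norm_nonneg _).trans (hM w hw)
      refine (norm_rayInt_le (hnorm f M hM) hch hω hμ hw).trans ?_
      -- The decay rate `c / h` and the forcing `h⁻¹ • f` compensate exactly: this is the uniformity
      -- in `h`.
      calc ‖ω‖ / (c / h) * (h⁻¹ * M) = ‖ω‖ / c * M := by field_simp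
        _ ≤ (1 + κ) / c * M := by gcongr
    · intro f g hf hg w hw
      obtain ⟨M, hM⟩ := hf.bdd
      obtain ⟨M', hM'⟩ := hg.bdd
      simp only [rayInt]
      rw [← smul_sub, ← integral_sub
        (integrable_ray (hf.const_smul _).diff.continuousOn (hnorm f M hM) hch hω hμ hw)
        (integrable_ray (hg.const_smul _).diff.continuousOn (hnorm g M' hM') hch hω hμ hw)]
      simp only [smul_sub]
    · intro f hf A hA w hw
      obtain ⟨M, hM⟩ := hf.bdd
      simp only [rayInt]
      rw [map_smul, ← A.integral_comp_comm
        (integrable_ray (hf.const_smul _).diff.continuousOn (hnorm f M hM) hch hω hμ hw),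
        setIntegral_eq_zero_of_forall_eq_zero, smul_zero]
      intro s hs
      rw [map_smul, map_smul, hA _ (add_mul_mem_cone hw hω (le_of_lt hs)), smul_zero, smul_zero]
  · have hμ : ∀ w ∈ cone κ, c / h * w.re ≤ (l / h * w).re := by
      intro w hw
      have hw' : |w.im| < κ * w.re := hw
      have hre := re_pos_of_mem_cone hκ hw
      rw [div_mul_eq_mul_div, div_mul_eq_mul_div, Complex.div_ofReal_re, Complex.mul_re]
      refine div_le_div_of_nonneg_right ?_ hh.le
      have h1 : l.im * w.im ≤ |l.im| * |w.im| := by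
        rw [← abs_mul]; exact le_abs_self _
      have h2 : |l.im| * |w.im| ≤ |l.im| * (κ * w.re) :=
        mul_le_mul_of_nonneg_left hw'.le (abs_nonneg _)
      have h3 := mul_le_mul_of_nonneg_right hpos hre.le
      linarith
    refine ⟨fun f => vertexInt (l / h) (fun w => (h : ℂ)⁻¹ • f w), ⟨?_, ?_, ?_, ?_⟩, ?_⟩
    · exact fun f hf => (hf.const_smul _).vertexInt hκ hch hμ
    · intro f hf w hw
      refine (hasDerivAt_vertexInt (hf.const_smul _) hκ hch hμ hw).congr_deriv ?_
      simp only [smul_add, smul_smul]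
      rw [div_eq_inv_mul]
    · intro f hf M hM w hw
      refine (norm_vertexInt_le (hnorm f M hM) hκ hch hμ hw).trans_eq ?_
      field_simp
    · intro f g hf hg w hw
      obtain ⟨M, hM⟩ := hf.bdd
      obtain ⟨M', hM'⟩ := hg.bdd
      simp only [vertexInt]
      rw [← neg_sub_neg, neg_neg, neg_neg, ← smul_sub, ← integral_sub
        (integrable_vertex (hg.const_smul _).diff.continuousOn (hnorm g M' hM') hκ hch hμ hw)
        (integrable_vertex (hf.const_smul _).diff.continuousOn (hnorm f M hM) hκ hch hμ hw),
        ← smul_neg, ← integral_neg]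
      simp only [smul_sub, neg_sub]
    · intro f hf A hA w hw
      obtain ⟨M, hM⟩ := hf.bdd
      simp only [vertexInt]
      rw [map_neg, map_smul, ← A.integral_comp_comm
        (integrable_vertex (hf.const_smul _).diff.continuousOn (hnorm f M hM) hκ hch hμ hw),
        setIntegral_eq_zero_of_forall_eq_zero, smul_zero, neg_zero]
      intro t ht
      rw [map_smul, map_smul, hA _ (smul_mem_cone hw (sub_pos.2 ht.2)), smul_zero, smul_zero]

end GreenFunction

/-! ### Green operators of matrices and the fixed point -/

section Contraction

variable {E : Type*} [NormedAddCommGroup E] [NormedSpace ℂ E]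

/-- The norm of the Green operator obtained by composing `k` scalar ones of norm at most `γ`
with operators of norm at most `B`. -/
def greenConst (γ B : ℝ) : ℕ → ℝ
  | 0 => 0
  | k + 1 => γ + greenConst γ B k * (B * γ)

/-- If `g` solves the scalar equation for `l`, then `g + u` solves the equation for `L` as soon as
`-h u' = L u + (L - l) g`. The new forcing is annihilated by a product with one factor fewer; for
the empty product the forcing is `0`. -/
theorem exists_green_of_list [CompleteSpace E] {κ c h γ B : ℝ} (hκ : 0 < κ) (hc : 0 < c)
    (hh : 0 < h) (hγ : (1 + κ) / c ≤ γ) (L : E →L[ℂ] E) (ls : List ℂ)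
    (hls : ∀ l ∈ ls, c ≤ abs (l.re - κ * |l.im|))
    (hB : ∀ l ∈ ls, ‖L - algebraMap ℂ (E →L[ℂ] E) l‖ ≤ B) :
    ∃ G : (ℂ → E) → ℂ → E, (∀ f, ConeAdm κ f → ConeAdm κ (G f)) ∧
      (∀ f, ConeAdm κ f → (∀ w ∈ cone κ, Polynomial.aeval L
        (ls.map fun l => Polynomial.X - Polynomial.C l).prod (f w) = 0) → ∀ w ∈ cone κ,
        HasDerivAt (G f) (-((h : ℂ)⁻¹ • (L (G f w) + f w))) w) ∧
      (∀ f, ConeAdm κ f → ∀ M, (∀ w ∈ cone κ, ‖f w‖ ≤ M) →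
        ∀ w ∈ cone κ, ‖G f w‖ ≤ greenConst γ B ls.length * M) ∧
      (∀ f g, ConeAdm κ f → ConeAdm κ g → ∀ w ∈ cone κ,
        G (fun v => f v - g v) w = G f w - G g w) := by
  induction ls with
  | nil =>
    refine ⟨fun _ _ => 0, fun f _ => ConeAdm.const κ 0, fun f _ h0 w hw => ?_, ?_, ?_⟩
    · have : f w = 0 := by simpa using h0 w hw
      simpa [this] using hasDerivAt_const w (0 : E)
    · simp [greenConst]
    · simp
  | cons l ls ih =>
    obtain ⟨G₁, hadm₁, hder₁, hbd₁, hsub₁⟩ := ih (fun l' h' => hls l' (List.mem_cons_of_mem _ h'))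
      (fun l' h' => hB l' (List.mem_cons_of_mem _ h'))
    obtain ⟨G₀, hG₀, hker⟩ := exists_isGreen_smul (E := E) hκ hc hh (hls l List.mem_cons_self)
    set A : E →L[ℂ] E := L - algebraMap ℂ (E →L[ℂ] E) l with hA
    have hAapp : ∀ x, A x = L x - l • x := fun x => rfl
    have hBA : ‖A‖ ≤ B := hB l List.mem_cons_self
    have hadm : ∀ f, ConeAdm κ f → ConeAdm κ fun w => A (G₀ f w) :=
      fun f hf => (hG₀.adm f hf).clm_comp A
    have hbd₀ : ∀ f, ConeAdm κ f → ∀ M, (∀ w ∈ cone κ, ‖f w‖ ≤ M) → ∀ w ∈ cone κ,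
        ‖G₀ f w‖ ≤ γ * M := fun f hf M hM w hw => (hG₀.bound f hf M hM w hw).trans
      (mul_le_mul_of_nonneg_right hγ ((norm_nonneg _).trans (hM w hw)))
    refine ⟨fun f w => G₀ f w + G₁ (fun v => A (G₀ f v)) w,
      fun f hf => (hG₀.adm f hf).add (hadm₁ _ (hadm f hf)), fun f hf h0 w hw => ?_,
      fun f hf M hM w hw => ?_, fun f g hf hg w hw => ?_⟩
    · have hk : ∀ v ∈ cone κ, Polynomial.aeval L
          (ls.map fun l => Polynomial.X - Polynomial.C l).prod (A (G₀ f v)) = 0 := by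
        intro v hv
        have h1 := hker f hf _ h0 v hv
        rw [List.map_cons, List.prod_cons, mul_comm, map_mul] at h1
        simpa [hA] using h1
      refine ((hG₀.deriv f hf w hw).add (hder₁ _ (hadm f hf) hk w hw)).congr_deriv ?_
      rw [← neg_add, ← smul_add, map_add, hAapp]
      congr 2
      abel
    · have h1 := hbd₀ f hf M hM
      have h2 := hbd₁ _ (hadm f hf) (B * (γ * M)) (fun v hv =>
        (A.le_opNorm_of_le (h1 v hv)).trans (mul_le_mul_of_nonneg_right hBA
          ((norm_nonneg _).trans (h1 v hv)))) w hw
      refine (norm_add_le _ _).trans ((add_le_add (h1 w hw) h2).trans_eq ?_)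
      rw [List.length_cons, greenConst]
      ring
    · have h1 := hG₀.sub f g hf hg
      have hfg := hadm _ (hf.sub hg)
      -- Additivity of `G₀` is known only on the cone, so the two arguments of `G₁` may differ as
      -- functions. Their difference vanishes on the cone, and the bound with `M = 0` shows that
      -- `G₁` does not see it.
      have h2 := hbd₁ _ (hfg.sub ((hadm f hf).sub (hadm g hg))) 0 (fun v hv => by
        simp only [h1 v hv, map_sub, sub_self, norm_zero, le_refl]) w hw
      rw [hsub₁ _ _ hfg ((hadm f hf).sub (hadm g hg)) w hw,
        hsub₁ _ _ (hadm f hf) (hadm g hg) w hw, mul_zero, norm_le_zero_iff, sub_eq_zero] at h2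
      simp only
      rw [h2, h1 w hw]
      abel

/-- The chain runs over the roots of the characteristic polynomial; by Cayley–Hamilton it
annihilates every forcing. -/
theorem exists_isGreen [CompleteSpace E] [FiniteDimensional ℂ E] {κ c h γ B : ℝ} (hκ : 0 < κ)
    (hc : 0 < c) (hh : 0 < h) (hγ : (1 + κ) / c ≤ γ) (L : E →L[ℂ] E)
    (hL : ∀ l, Module.End.HasEigenvalue (L : E →ₗ[ℂ] E) l →
      c ≤ abs (l.re - κ * |l.im|) ∧ ‖L - algebraMap ℂ (E →L[ℂ] E) l‖ ≤ B) :
    ∃ G, IsGreen κ h L (greenConst γ B (Module.finrank ℂ E)) G := by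
  have hroot : ∀ l ∈ (L : E →ₗ[ℂ] E).charpoly.roots.toList,
      Module.End.HasEigenvalue (L : E →ₗ[ℂ] E) l := by
    intro l hl
    rw [Multiset.mem_toList, Polynomial.mem_roots (LinearMap.charpoly_monic _).ne_zero] at hl
    exact (Module.End.hasEigenvalue_iff_isRoot_charpoly _ _).2 hl
  have hsplit := IsAlgClosed.splits (L : E →ₗ[ℂ] E).charpoly
  have hlen : (L : E →ₗ[ℂ] E).charpoly.roots.toList.length = Module.finrank ℂ E := by
    rw [Multiset.length_toList, ← hsplit.natDegree_eq_card_roots, LinearMap.charpoly_natDegree]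
  have hprod : ((L : E →ₗ[ℂ] E).charpoly.roots.toList.map
      fun l => Polynomial.X - Polynomial.C l).prod = (L : E →ₗ[ℂ] E).charpoly := by
    rw [← Multiset.prod_coe, ← Multiset.map_coe, Multiset.coe_toList]
    exact (hsplit.eq_prod_roots_of_monic (LinearMap.charpoly_monic _)).symm
  obtain ⟨G, h₁, h₂, h₃, h₄⟩ := exists_green_of_list hκ hc hh hγ L
    (L : E →ₗ[ℂ] E).charpoly.roots.toList (fun l hl => (hL l (hroot l hl)).1)
    (fun l hl => (hL l (hroot l hl)).2)
  rw [hlen] at h₃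
  refine ⟨G, h₁, fun f hf => h₂ f hf fun w _ => ?_, h₃, h₄⟩
  rw [hprod]
  have h5 : (Polynomial.aeval L (L : E →ₗ[ℂ] E).charpoly : E →L[ℂ] E).toLinearMap =
      Polynomial.aeval (L : E →ₗ[ℂ] E) (L : E →ₗ[ℂ] E).charpoly :=
    (Polynomial.aeval_algHom_apply
      ({ ContinuousLinearMap.toLinearMapRingHom with commutes' := fun _ => rfl } :
        (E →L[ℂ] E) →ₐ[ℂ] (E →ₗ[ℂ] E)) L _).symm
  rw [LinearMap.aeval_self_charpoly] at h5
  exact LinearMap.congr_fun h5 (f w)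

instance coneAtInf_neBot {κ : ℝ} [Fact (0 < κ)] : (coneAtInf κ).NeBot := by
  have : Tendsto (fun x : ℝ => (x : ℂ)) atTop (coneAtInf κ) := by
    refine tendsto_coneAtInf (tendsto_id (α := ℝ) (x := atTop)) ?_
    filter_upwards [eventually_gt_atTop 0] with x hx
    simpa [cone] using mul_pos Fact.out hx
  exact this.neBot

/-- Uniform convergence preserves holomorphy and lets the limits in `k` and at infinity be
interchanged. -/
theorem ConeAdm.of_dist_le [CompleteSpace E] {κ : ℝ} (hκ : 0 < κ) {Y : ℕ → ℂ → E} {y : ℂ → E}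
    {R : ℝ} (hY : ∀ k, ConeAdm κ (Y k))
    (hstep : ∀ k, ∀ w ∈ cone κ, dist (Y k w) (Y (k + 1) w) ≤ R / 2 / 2 ^ k)
    (hlim : ∀ k, ∀ w ∈ cone κ, dist (Y k w) (y w) ≤ R / 2 ^ k) : ConeAdm κ y := by
  have : Fact (0 < κ) := ⟨hκ⟩
  have hunif : TendstoUniformlyOn Y y atTop (cone κ) := by
    rw [Metric.tendstoUniformlyOn_iff]
    intro ε hε
    have : Tendsto (fun k : ℕ => R / 2 ^ k) atTop (𝓝 0) :=
      tendsto_const_nhds.div_atTop (tendsto_pow_atTop_atTop_of_one_lt one_lt_two)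
    filter_upwards [this.eventually_lt_const hε] with k hk w hw
    rw [dist_comm]
    exact (hlim k w hw).trans_lt hk
  choose l hl using fun k => (hY k).lim
  have hcau : CauchySeq l := by
    refine cauchySeq_of_le_geometric_two (C := R) fun k => ?_
    refine le_of_tendsto ((hl k).dist (hl (k + 1))) ?_
    filter_upwards [eventually_mem_cone κ] with w hw using hstep k w hw
  obtain ⟨l₀, hl₀⟩ := cauchySeq_tendsto_of_complete hcau
  obtain ⟨M, hM⟩ := (hY 0).bdd
  refine ⟨hunif.tendstoLocallyUniformlyOn.differentiableOn
    (Eventually.of_forall fun k => (hY k).diff) (isOpen_cone κ), ⟨M + R, fun w hw => ?_⟩, l₀, ?_⟩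
  · have h1 := hlim 0 w hw
    rw [pow_zero, div_one, dist_comm, dist_eq_norm] at h1
    calc ‖y w‖ = ‖Y 0 w + (y w - Y 0 w)‖ := by simp
      _ ≤ M + R := (norm_add_le _ _).trans (add_le_add (hM w hw) h1)
  · refine TendstoUniformlyOnFilter.tendsto_of_eventually_tendsto (p' := coneAtInf κ)
      ((tendstoUniformlyOn_iff_tendstoUniformlyOnFilter.1 hunif).mono_right inf_le_right)
      (Eventually.of_forall hl) hl₀

/-- A bounded solution of `-h y' = L y + F(w, y)` on the cone, by contraction. -/
theorem IsGreen.exists_solution [CompleteSpace E] {κ h Γ : ℝ} {L : E → E}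
    {G : (ℂ → E) → ℂ → E} (hG : IsGreen κ h L Γ G) (hκ : 0 < κ) {F : ℂ → E → E} {R M ε : ℝ}
    (hR : 0 ≤ R) (hε : Γ * ε ≤ 1 / 2) (hM : Γ * M ≤ R / 2)
    (hF : ∀ y, ConeAdm κ y → ConeAdm κ fun w => F w (y w))
    (hlip : ∀ w ∈ cone κ, ∀ a b, ‖a‖ ≤ R → ‖b‖ ≤ R → ‖F w a - F w b‖ ≤ ε * ‖a - b‖)
    (hε0 : 0 ≤ ε) (hF0 : ∀ w ∈ cone κ, ‖F w 0‖ ≤ M) :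
    ∃ y, ConeAdm κ y ∧ (∀ w ∈ cone κ, ‖y w‖ ≤ R) ∧
      ∀ w ∈ cone κ, HasDerivAt y (-((h : ℂ)⁻¹ • (L (y w) + F w (y w)))) w := by
  -- A solution is a fixed point of `Φ`, which halves sup-distances over the cone in the ball of
  -- radius `R`. The iteration starts at `0`, and `Γ * M ≤ R / 2` keeps it in that ball.
  set Φ : (ℂ → E) → ℂ → E := fun y => G fun w => F w (y w) with hΦ
  have hΦadm : ∀ y, ConeAdm κ y → ConeAdm κ (Φ y) := fun y hy => hG.adm _ (hF y hy)
  have hΦlip : ∀ y₁ y₂, ConeAdm κ y₁ → ConeAdm κ y₂ → (∀ w ∈ cone κ, ‖y₁ w‖ ≤ R) →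
      (∀ w ∈ cone κ, ‖y₂ w‖ ≤ R) → ∀ D, 0 ≤ D → (∀ w ∈ cone κ, ‖y₁ w - y₂ w‖ ≤ D) →
      ∀ w ∈ cone κ, ‖Φ y₁ w - Φ y₂ w‖ ≤ D / 2 := by
    intro y₁ y₂ h₁ h₂ hb₁ hb₂ D hD0 hD w hw
    rw [hΦ]
    simp only
    rw [← hG.sub _ _ (hF _ h₁) (hF _ h₂) w hw]
    refine (hG.bound _ ((hF _ h₁).sub (hF _ h₂)) (ε * D) (fun v hv => ?_) w hw).trans ?_
    · exact (hlip v hv _ _ (hb₁ v hv) (hb₂ v hv)).trans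
        (mul_le_mul_of_nonneg_left (hD v hv) hε0)
    · nlinarith
  have hzero : ∀ w ∈ cone κ, ‖Φ (fun _ => 0) w‖ ≤ R / 2 := fun w hw =>
    (hG.bound _ (hF _ (ConeAdm.const κ 0)) M hF0 w hw).trans hM
  set Y : ℕ → ℂ → E := fun k => Φ^[k] (fun _ => 0) with hYdef
  have hYs : ∀ k, Y (k + 1) = Φ (Y k) := fun k => Function.iterate_succ_apply' _ _ _
  have hY : ∀ k, ConeAdm κ (Y k) ∧ ∀ w ∈ cone κ, ‖Y k w‖ ≤ R := by
    intro k
    induction k with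
    | zero => exact ⟨ConeAdm.const κ 0, fun w _ => by simpa [hYdef] using hR⟩
    | succ k ih =>
      rw [hYs]
      refine ⟨hΦadm _ ih.1, fun w hw => ?_⟩
      have h1 := hΦlip (Y k) (fun _ => 0) ih.1 (ConeAdm.const κ 0) ih.2
        (fun _ _ => by simpa using hR) R hR (fun v hv => by simpa using ih.2 v hv) w hw
      calc ‖Φ (Y k) w‖ = ‖Φ (Y k) w - Φ (fun _ => 0) w + Φ (fun _ => 0) w‖ := by simp
        _ ≤ R / 2 + R / 2 := (norm_add_le _ _).trans (add_le_add h1 (hzero w hw))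
        _ = R := by ring
  have hstep : ∀ k, ∀ w ∈ cone κ, dist (Y k w) (Y (k + 1) w) ≤ R / 2 / 2 ^ k := by
    intro k
    induction k with
    | zero =>
      intro w hw
      rw [dist_comm, dist_eq_norm, hYs]
      simpa [hYdef] using hzero w hw
    | succ k ih =>
      intro w hw
      rw [hYs (k + 1)]
      nth_rewrite 1 [hYs k]
      rw [dist_eq_norm]
      refine (hΦlip _ _ (hY k).1 (hY (k + 1)).1 (hY k).2 (hY (k + 1)).2 (R / 2 / 2 ^ k)
        (by positivity) (fun v hv => ?_) w hw).trans_eq (by rw [pow_succ]; field_simp)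
      rw [← dist_eq_norm]
      exact ih v hv
  have hex : ∀ w, ∃ a, w ∈ cone κ → Tendsto (fun k => Y k w) atTop (𝓝 a) := by
    intro w
    by_cases hw : w ∈ cone κ
    · obtain ⟨a, ha⟩ := cauchySeq_tendsto_of_complete
        (cauchySeq_of_le_geometric_two fun k => hstep k w hw)
      exact ⟨a, fun _ => ha⟩
    · exact ⟨0, fun h => absurd h hw⟩
  choose y hy using hex
  have hdist : ∀ k, ∀ w ∈ cone κ, dist (Y k w) (y w) ≤ R / 2 ^ k := fun k w hw =>
    dist_le_of_le_geometric_two_of_tendsto (fun k => hstep k w hw) (hy w hw) k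
  have hyadm : ConeAdm κ y := ConeAdm.of_dist_le hκ (fun k => (hY k).1) hstep hdist
  have hyR : ∀ w ∈ cone κ, ‖y w‖ ≤ R := fun w hw =>
    le_of_tendsto (hy w hw).norm (Eventually.of_forall fun k => (hY k).2 w hw)
  have hfix : ∀ w ∈ cone κ, Φ y w = y w := by
    intro w hw
    refine tendsto_nhds_unique (f := fun k => Y (k + 1) w) ?_ ((hy w hw).comp (tendsto_add_atTop_nat 1))
    rw [tendsto_iff_dist_tendsto_zero]
    have h0 : Tendsto (fun k : ℕ => R / 2 ^ k / 2) atTop (𝓝 0) := by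
      simpa using (tendsto_const_nhds.div_atTop
        (tendsto_pow_atTop_atTop_of_one_lt (one_lt_two (α := ℝ))) (a := R)).div_const 2
    refine squeeze_zero (fun _ => dist_nonneg) (fun k => ?_) h0
    rw [hYs, dist_eq_norm]
    refine hΦlip _ _ (hY k).1 hyadm (hY k).2 hyR _ (by positivity) (fun v hv => ?_) w hw
    rw [← dist_eq_norm]
    exact hdist k v hv
  refine ⟨y, hyadm, hyR, fun w hw => ?_⟩
  have h1 := hG.deriv _ (hF y hyadm) w hw
  rw [show G (fun w => F w (y w)) w = y w from hfix w hw] at h1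
  refine h1.congr_of_eventuallyEq ?_
  filter_upwards [(isOpen_cone κ).mem_nhds hw] with v hv using (hfix v hv).symm

end Contraction

/-! ### Spectrum of the Sylvester operator and choice of the slope -/

section Sylvester

/-- From `B * Y = Y * (l + A)` follows `q(B) * Y = Y * q(l + A)` for every polynomial `q`. For the
characteristic polynomial of `B` the left side vanishes, so `q(l + A)` is singular and a root of `q`
lies in the spectrum of `l + A`. -/
theorem exists_sub_of_sylvester_eigenvalue {m n : Type*} [Fintype m] [Fintype n] [DecidableEq m]
    [DecidableEq n] {A : Matrix m m ℂ} {B : Matrix n n ℂ} {Y : Matrix n m ℂ} (hY : Y ≠ 0) {l : ℂ}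
    (h : B * Y - Y * A = l • Y) : ∃ a ∈ spectrum ℂ A, ∃ b ∈ spectrum ℂ B, l = b - a := by
  set A' : Matrix m m ℂ := algebraMap ℂ _ l + A with hA'
  have hBY : B * Y = Y * A' := by
    rw [hA', Matrix.mul_add, ← sub_eq_iff_eq_add, h, Algebra.algebraMap_eq_smul_one,
      Matrix.mul_smul, Matrix.mul_one]
  have hpow : ∀ k : ℕ, B ^ k * Y = Y * A' ^ k := by
    intro k
    induction k with
    | zero => simp
    | succ k ih => rw [pow_succ, Matrix.mul_assoc, hBY, ← Matrix.mul_assoc, ih, Matrix.mul_assoc,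
        ← pow_succ]
  have hpoly : ∀ q : Polynomial ℂ, Polynomial.aeval B q * Y = Y * Polynomial.aeval A' q := by
    intro q
    simp only [Polynomial.aeval_eq_sum_range, Matrix.sum_mul, Matrix.mul_sum,
      Matrix.smul_mul, Matrix.mul_smul, hpow]
  have h0 := hpoly B.charpoly
  rw [Matrix.aeval_self_charpoly, Matrix.zero_mul] at h0
  have hunit : ¬ IsUnit (Polynomial.aeval A' B.charpoly) := by
    intro hu
    apply hY
    obtain ⟨u, hu⟩ := hu
    rw [← hu] at h0
    calc Y = Y * ((u : Matrix m m ℂ) * ((u⁻¹ : (Matrix m m ℂ)ˣ) : Matrix m m ℂ)) := by rw [Units.mul_inv, Matrix.mul_one]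
      _ = 0 := by rw [← Matrix.mul_assoc, ← h0, Matrix.zero_mul]
  rw [(IsAlgClosed.splits B.charpoly).eq_prod_roots_of_monic B.charpoly_monic] at hunit
  obtain ⟨k, hk, hroot⟩ := spectrum.exists_mem_of_not_isUnit_aeval_prod hunit
  refine ⟨k - l, ?_, k, Matrix.mem_spectrum_iff_isRoot_charpoly.2 hroot, by ring⟩
  have : (k - l) + l ∈ spectrum ℂ (algebraMap ℂ _ l + A) := by simpa [hA'] using hk
  rwa [spectrum.add_mem_add_iff] at this

theorem exists_slope (s : Finset ℂ) {δ : ℝ} (hδ : 0 < δ) (hs : ∀ l ∈ s, δ ≤ ‖l‖) {d : ℕ}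
    (hd : s.card ≤ d) : ∃ κ : ℝ, 1 ≤ κ ∧ κ ≤ d + 1 ∧
      ∀ l ∈ s, δ / (8 * (d + 1)) ≤ abs (l.re - κ * |l.im|) := by
  -- There are `d + 1` candidate slopes and at most `d` rounded ratios, so some integer `k` is
  -- nearest to none of them.
  obtain ⟨k, hk, hks⟩ := Finset.exists_mem_notMem_of_card_lt_card
    (s := s.image fun l : ℂ => round (l.re / |l.im|)) (t := Finset.Icc (1 : ℤ) (d + 1))
    (lt_of_le_of_lt (Finset.card_image_le.trans hd) (by simp))
  rw [Finset.mem_Icc] at hk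
  have hk1 : (1 : ℝ) ≤ k := by exact_mod_cast hk.1
  have hk2 : (k : ℝ) ≤ d + 1 := by exact_mod_cast hk.2
  refine ⟨k, hk1, hk2, fun l hl => ?_⟩
  have hd1 : (0 : ℝ) < d + 1 := by positivity
  rcases le_or_gt (δ / (4 * (d + 1))) |l.im| with him | him
  · have himpos : 0 < |l.im| := lt_of_lt_of_le (by positivity) him
    have hhalf : 1 / 2 ≤ |l.re / |l.im| - k| := by
      by_contra! hlt
      refine hks (Finset.mem_image.2 ⟨l, hl, ?_⟩)
      have h1 := abs_sub_round (l.re / |l.im|)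
      have h2 : |((round (l.re / |l.im|) - k : ℤ) : ℝ)| < 1 := by
        push_cast
        rw [abs_lt] at hlt ⊢
        rw [abs_le] at h1
        constructor <;> linarith [hlt.1, hlt.2, h1.1, h1.2]
      have h3 : |round (l.re / |l.im|) - k| < 1 := by exact_mod_cast h2
      linarith [Int.abs_lt_one_iff.1 h3]
    have heq : l.re - k * |l.im| = |l.im| * (l.re / |l.im| - k) := by field_simp
    rw [heq, abs_mul, abs_abs]
    calc δ / (8 * (d + 1)) = δ / (4 * (d + 1)) * (1 / 2) := by field_simp; norm_num
      _ ≤ _ := mul_le_mul him hhalf (by norm_num) himpos.le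
  -- Here `l` is nearly real: `k * |l.im|` is at most `δ / 4`, whereas `|l.re|` is at least `3 * δ /
  -- 4`.
  · have h1 := (hs l hl).trans (Complex.norm_le_abs_re_add_abs_im l)
    have h2 : δ / (4 * (d + 1)) * (d + 1) = δ / 4 := by field_simp
    have h3 : k * |l.im| ≤ δ / 4 := by
      rw [← h2, mul_comm]
      exact mul_le_mul him.le hk2 (by linarith) (by positivity)
    have h4 : |l.im| ≤ δ / 4 := by nlinarith [abs_nonneg l.im]
    have h5 : δ / (8 * (d + 1)) ≤ δ / 8 := by
      gcongr
      have : (0 : ℝ) ≤ d := by positivity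
      linarith
    have h6 : |l.re| - k * |l.im| ≤ abs (l.re - k * |l.im|) := by
      have := abs_sub_abs_le_abs_sub l.re (k * |l.im|)
      rwa [abs_of_nonneg (a := k * |l.im|) (by positivity)] at this
    linarith

/-- A uniform bound for Green operators on suitable cones. -/
theorem exists_uniform_green (E : Type*) [NormedAddCommGroup E] [NormedSpace ℂ E]
    [FiniteDimensional ℂ E] {δ : ℝ} (hδ : 0 < δ) (K : ℝ) :
    ∃ Γ > 0, ∀ L₀ : E →ₗ[ℂ] E, (∀ x, ‖L₀ x‖ ≤ K * ‖x‖) →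
      (∀ l, Module.End.HasEigenvalue L₀ l → δ ≤ ‖l‖) → ∀ h : ℝ, 0 < h →
      ∃ κ : ℝ, 1 ≤ κ ∧ ∃ G, IsGreen κ h L₀ Γ G := by
  have : CompleteSpace E := FiniteDimensional.complete ℂ E
  set d := Module.finrank ℂ E
  set c := δ / (8 * (d + 1) : ℝ) with hc
  have hcpos : 0 < c := by positivity
  -- `(d + 2) / c` bounds `(1 + κ) / c` because `κ ≤ d + 1`, and `2 * max K 0` bounds `‖L - l‖` for
  -- every eigenvalue `l`. Neither involves `κ` or `h`.
  set Γ := greenConst ((d + 2) / c) (2 * max K 0) d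
  refine ⟨max Γ 1, lt_max_of_lt_right one_pos, fun L₀ hL₀ hev h hh => ?_⟩
  set L : E →L[ℂ] E := L₀.mkContinuous K hL₀
  have hLx : ∀ x, L x = L₀ x := fun _ => rfl
  have hmem : ∀ l, l ∈ (L : E →ₗ[ℂ] E).charpoly.roots.toFinset ↔
      Module.End.HasEigenvalue (L : E →ₗ[ℂ] E) l := by
    intro l
    rw [Multiset.mem_toFinset, Polynomial.mem_roots (LinearMap.charpoly_monic _).ne_zero]
    exact (Module.End.hasEigenvalue_iff_isRoot_charpoly _ _).symm
  obtain ⟨κ, hκ1, hκ2, hκ⟩ := exists_slope (L : E →ₗ[ℂ] E).charpoly.roots.toFinset hδ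
    (fun l hl => hev l ((hmem l).1 hl)) (d := d) (by
      refine (Multiset.toFinset_card_le _).trans ((Polynomial.card_roots' _).trans ?_)
      rw [LinearMap.charpoly_natDegree])
  obtain ⟨G, hG⟩ := exists_isGreen (γ := (d + 2) / c) (B := 2 * max K 0) (by linarith : 0 < κ) hcpos hh
    (div_le_div_of_nonneg_right (by linarith) hcpos.le) L (fun l hl => ⟨hκ l ((hmem l).2 hl), by
      obtain ⟨v, hv⟩ := hl.exists_hasEigenvector
      have h1 : L v = l • v := hv.apply_eq_smul
      have h2 : ‖l‖ * ‖v‖ ≤ ‖L‖ * ‖v‖ := by rw [← norm_smul, ← h1]; exact L.le_opNorm v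
      have hL : ‖L‖ ≤ max K 0 := L₀.mkContinuous_norm_le' hL₀
      have h3 : ‖l‖ ≤ max K 0 := (le_of_mul_le_mul_right h2 (norm_pos_iff.2 hv.2)).trans hL
      have h4 : ‖algebraMap ℂ (E →L[ℂ] E) l‖ ≤ ‖l‖ := by
        rw [Algebra.algebraMap_eq_smul_one, norm_smul]
        exact mul_le_of_le_one_right (norm_nonneg _) ContinuousLinearMap.norm_id_le
      linarith [norm_sub_le L (algebraMap ℂ (E →L[ℂ] E) l)]⟩)
  refine ⟨κ, hκ1, G, hG.adm, hG.deriv, fun f hf M hM w hw => ?_, hG.sub⟩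
  exact (hG.bound f hf M hM w hw).trans
    (mul_le_mul_of_nonneg_right (le_max_left _ _) ((norm_nonneg _).trans (hM w hw)))

end Sylvester

/-! ### Bounded solutions of the Riccati equation -/

section Riccati

attribute [local instance] Matrix.normedAddCommGroup Matrix.normedSpace

/-- The norm in force is the largest modulus of an entry, which is not submultiplicative; the factor
counts the terms in an entry of the product. -/
theorem norm_matrix_mul_le {a b c : Type*} [Fintype a] [Fintype b] [Fintype c]
    (M : Matrix a b ℂ) (N : Matrix b c ℂ) : ‖M * N‖ ≤ Fintype.card b * (‖M‖ * ‖N‖) := by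
  rw [Matrix.norm_le_iff (by positivity)]
  intro i j
  rw [Matrix.mul_apply]
  refine (norm_sum_le _ _).trans ?_
  rw [← nsmul_eq_mul, ← Finset.card_univ]
  refine Finset.sum_le_card_nsmul _ _ _ fun k _ => ?_
  rw [norm_mul]
  exact mul_le_mul (Matrix.norm_entry_le_entrywise_sup_norm M)
    (Matrix.norm_entry_le_entrywise_sup_norm N) (norm_nonneg _) (norm_nonneg _)

theorem differentiableOn_matrix {a b : Type*} [Fintype a] [Fintype b] {f : ℂ → Matrix a b ℂ}
    {U : Set ℂ} :
    DifferentiableOn ℂ f U ↔ ∀ i j, DifferentiableOn ℂ (fun z => f z i j) U :=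
  (differentiableOn_pi (Φ := f)).trans (forall_congr' fun _ => differentiableOn_pi)

theorem ConeAdm.matrix_mul {a b c : Type*} [Fintype a] [Fintype b] [Fintype c] {κ : ℝ}
    {f : ℂ → Matrix a b ℂ} {g : ℂ → Matrix b c ℂ} (hf : ConeAdm κ f) (hg : ConeAdm κ g) :
    ConeAdm κ (fun w => f w * g w) := by
  obtain ⟨M, hM⟩ := hf.bdd
  obtain ⟨l, hl⟩ := hf.lim
  obtain ⟨M', hM'⟩ := hg.bdd
  obtain ⟨l', hl'⟩ := hg.lim
  refine ⟨differentiableOn_matrix.2 fun i j => ?_, ⟨Fintype.card b * (M * M'), fun w hw => ?_⟩,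
    l * l', ?_⟩
  · simp only [Matrix.mul_apply]
    exact DifferentiableOn.fun_sum fun k _ =>
      (differentiableOn_matrix.1 hf.diff i k).mul (differentiableOn_matrix.1 hg.diff k j)
  · refine (norm_matrix_mul_le _ _).trans (mul_le_mul_of_nonneg_left ?_ (by positivity))
    exact mul_le_mul (hM w hw) (hM' w hw) (norm_nonneg _) ((norm_nonneg _).trans (hM w hw))
  · have hl₁ : ∀ i j, Tendsto (fun w => f w i j) (coneAtInf κ) (𝓝 (l i j)) := fun i j =>
      tendsto_pi_nhds.1 (tendsto_pi_nhds.1 hl i) j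
    have hl₂ : ∀ i j, Tendsto (fun w => g w i j) (coneAtInf κ) (𝓝 (l' i j)) := fun i j =>
      tendsto_pi_nhds.1 (tendsto_pi_nhds.1 hl' i) j
    refine tendsto_pi_nhds.2 fun i => tendsto_pi_nhds.2 fun j => ?_
    simp only [Matrix.mul_apply]
    exact tendsto_finsetSum _ fun k _ => (hl₁ i k).mul (hl₂ k j)

theorem norm_mul_exp_neg_lt {κ ρ : ℝ} (hκ : 0 < κ) (hρ : 0 < ρ) {w : ℂ} (hw : w ∈ cone κ) :
    ‖(ρ : ℂ) * Complex.exp (-w)‖ < ρ := by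
  rw [norm_mul, Complex.norm_real, Real.norm_of_nonneg hρ.le, Complex.norm_exp]
  refine mul_lt_of_lt_one_right hρ (Real.exp_lt_one_iff.2 ?_)
  simpa using re_pos_of_mem_cone hκ hw

theorem ConeAdm.comp_exp {E : Type*} [NormedAddCommGroup E] [NormedSpace ℂ E] {κ ρ r K : ℝ}
    (hκ : 0 < κ) (hρ : 0 < ρ) (hr : ρ ≤ r) {f : ℂ → E}
    (hf : DifferentiableOn ℂ f (Metric.ball 0 r)) (hK : ∀ z ∈ Metric.ball 0 r, ‖f z‖ ≤ K) :
    ConeAdm κ (fun w => f (ρ * Complex.exp (-w))) := by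
  have hmem : ∀ w ∈ cone κ, (ρ : ℂ) * Complex.exp (-w) ∈ Metric.ball (0 : ℂ) r := fun w hw => by
    rw [mem_ball_zero_iff]
    exact (norm_mul_exp_neg_lt hκ hρ hw).trans_le hr
  refine ⟨hf.comp (by fun_prop) hmem, ⟨K, fun w hw => hK _ (hmem w hw)⟩, f 0, ?_⟩
  have h0 : ContinuousAt f 0 := (hf.differentiableAt
    (Metric.ball_mem_nhds _ (hρ.trans_le hr))).continuousAt
  refine h0.tendsto.comp ?_
  refine squeeze_zero_norm (a := fun w : ℂ => ρ * Real.exp (-w.re)) (fun w => ?_) ?_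
  · rw [norm_mul, Complex.norm_real, Real.norm_of_nonneg hρ.le, Complex.norm_exp, Complex.neg_re]
  · simpa using ((Real.tendsto_exp_neg_atTop_nhds_zero.comp
      (tendsto_re_coneAtInf κ)).const_mul ρ)

/-- A Schwarz lemma: it makes the variation of the coefficients around `z = 0` small with `ρ`,
uniformly in `h`. -/
theorem norm_sub_apply_zero_le {E : Type*} [NormedAddCommGroup E] [NormedSpace ℂ E] {r K : ℝ}
    {f : ℂ → E} (hf : DifferentiableOn ℂ f (Metric.ball 0 r))
    (hK : ∀ z ∈ Metric.ball 0 r, ‖f z‖ ≤ K) {z : ℂ} (hz : z ∈ Metric.ball 0 r) :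
    ‖f z - f 0‖ ≤ 2 * K / r * ‖z‖ := by
  have h0 : (0 : ℂ) ∈ Metric.ball (0 : ℂ) r :=
    Metric.mem_ball_self (dist_nonneg.trans_lt (Metric.mem_ball.1 hz))
  have := Complex.dist_le_div_mul_dist_of_mapsTo_ball (R₂ := 2 * K) hf (fun v hv => by
    rw [mem_closedBall_iff_norm]
    linarith [norm_sub_le (f v) (f 0), hK v hv, hK 0 h0]) hz
  rwa [dist_eq_norm, dist_zero_right] at this

/-- The coordinate in which the slit disk becomes part of a cone. -/
theorem log_sub_log_mem_cone {κ ρ : ℝ} (hκ : 1 ≤ κ) (hρ : 0 < ρ) {z : ℂ}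
    (hz : z ∈ slitBall (ρ * Real.exp (-Real.pi))) :
    (Real.log ρ : ℂ) - Complex.log z ∈ cone κ := by
  have hz0 : z ≠ 0 := Complex.slitPlane_ne_zero hz.2
  have h1 : ‖z‖ < ρ * Real.exp (-Real.pi) := by simpa using hz.1
  have h2 : Real.log ‖z‖ < Real.log ρ - Real.pi := by
    have := Real.log_lt_log (norm_pos_iff.2 hz0) h1
    rwa [Real.log_mul hρ.ne' (Real.exp_pos _).ne', Real.log_exp, ← sub_eq_add_neg] at this
  have h3 := Complex.abs_arg_le_pi z
  have hpi := Real.pi_pos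
  simp only [cone, mem_ofPred_eq, Complex.sub_im, Complex.ofReal_im, Complex.log_im, zero_sub,
    abs_neg, Complex.sub_re, Complex.ofReal_re, Complex.log_re]
  -- The modulus of the argument is at most `π`, the real part of the new coordinate exceeds `π`,
  -- and `κ ≥ 1`.
  nlinarith

theorem mul_exp_neg_log_sub_log {ρ : ℝ} (hρ : 0 < ρ) {z : ℂ} (hz : z ≠ 0) :
    (ρ : ℂ) * Complex.exp (-((Real.log ρ : ℂ) - Complex.log z)) = z := by
  rw [neg_sub, Complex.exp_sub, Complex.exp_log hz, ← Complex.ofReal_exp, Real.exp_log hρ]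
  have : (ρ : ℂ) ≠ 0 := Complex.ofReal_ne_zero.2 hρ.ne'
  field_simp

theorem tendsto_log_sub_log {κ ρ : ℝ} (hκ : 1 ≤ κ) (hρ : 0 < ρ) :
    Tendsto (fun z : ℂ => (Real.log ρ : ℂ) - Complex.log z)
      (𝓝[slitBall (ρ * Real.exp (-Real.pi))] 0) (coneAtInf κ) := by
  refine tendsto_coneAtInf ?_ ?_
  · have h : Tendsto (fun z : ℂ => Real.log ‖z‖)
        (𝓝[slitBall (ρ * Real.exp (-Real.pi))] 0) atBot :=
      (Real.tendsto_log_nhdsGT_zero.comp (tendsto_norm_nhdsNE_zero (E := ℂ))).mono_left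
        (nhdsWithin_mono _ fun z hz => Complex.slitPlane_ne_zero hz.2)
    simpa [sub_eq_add_neg, Complex.log_re] using
      tendsto_atTop_add_const_left _ (Real.log ρ) (tendsto_neg_atBot_atTop.comp h)
  · filter_upwards [self_mem_nhdsWithin] with z hz using log_sub_log_mem_cone hκ hρ hz

theorem isOpen_slitBall (ρ : ℝ) : IsOpen (slitBall ρ) :=
  Metric.isOpen_ball.inter Complex.isOpen_slitPlane

/-- The Sylvester operator `Y ↦ B Y - Y A`. -/
def sylvesterMap {m n : Type*} [Fintype m] [Fintype n] (A : Matrix m m ℂ) (B : Matrix n n ℂ) :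
    Matrix n m ℂ →ₗ[ℂ] Matrix n m ℂ where
  toFun Y := B * Y - Y * A
  map_add' X Y := by rw [Matrix.mul_add, Matrix.add_mul]; abel
  map_smul' a Y := by simp [smul_sub]

theorem norm_sub_add_sub_le {E : Type*} [SeminormedAddCommGroup E] {a b c d : E} {α β γ δ : ℝ}
    (ha : ‖a‖ ≤ α) (hb : ‖b‖ ≤ β) (hc : ‖c‖ ≤ γ) (hd : ‖d‖ ≤ δ) :
    ‖a - b + c - d‖ ≤ α + β + γ + δ :=
  (norm_sub_le _ _).trans (add_le_add ((norm_add_le _ _).trans (add_le_add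
    ((norm_sub_le _ _).trans (add_le_add ha hb)) hc)) hd)

/-- The Lipschitz estimate for the nonlinearity of the Riccati equation. -/
theorem norm_riccati_sub_le {m n : Type*} [Fintype m] [Fintype n] {A S : Matrix m m ℂ}
    {B Q : Matrix n n ℂ} {P X Y : Matrix n m ℂ} {U : Matrix m n ℂ} {β K R η : ℝ} (hη : 0 ≤ η)
    (hB : ‖B‖ ≤ β) (hA : ‖A‖ ≤ β) (hQ : ‖Q‖ ≤ K) (hS : ‖S‖ ≤ K) (hU : ‖U‖ ≤ K)
    (hX : ‖X‖ ≤ R) (hY : ‖Y‖ ≤ R) :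
    ‖(B * X - X * A + P + (η : ℂ) • (Q * X - X * S) - ((η : ℂ) ^ 2) • (X * U * X)) -
      (B * Y - Y * A + P + (η : ℂ) • (Q * Y - Y * S) - ((η : ℂ) ^ 2) • (Y * U * Y))‖ ≤
    (2 * ((Fintype.card m + Fintype.card n) * β) +
      η * (2 * ((Fintype.card m + Fintype.card n) * K)) +
      η ^ 2 * (2 * ((Fintype.card m + Fintype.card n) *
        ((Fintype.card m + Fintype.card n) * (R * K))))) * ‖X - Y‖ := by
  set N : ℝ := Fintype.card m + Fintype.card n with hN
  have hN0 : 0 ≤ N := by positivity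
  have hmN : (Fintype.card m : ℝ) ≤ N := by simp [hN]
  have hnN : (Fintype.card n : ℝ) ≤ N := by simp [hN]
  have hβ0 := (norm_nonneg B).trans hB
  have hK0 := (norm_nonneg U).trans hU
  have hR0 := (norm_nonneg X).trans hX
  set D := X - Y with hD
  have hD0 := norm_nonneg D
  have hdiff : (B * X - X * A + P + (η : ℂ) • (Q * X - X * S) - ((η : ℂ) ^ 2) • (X * U * X)) -
      (B * Y - Y * A + P + (η : ℂ) • (Q * Y - Y * S) - ((η : ℂ) ^ 2) • (Y * U * Y)) =
      B * D - D * A + (η : ℂ) • (Q * D - D * S) -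
        ((η : ℂ) ^ 2) • (D * U * X + Y * U * D) := by
    simp only [hD, Matrix.mul_sub, Matrix.sub_mul, smul_sub, smul_add]
    abel
  have hmul : ∀ {x y z c : ℝ}, c ≤ N → 0 ≤ x → 0 ≤ y → z ≤ c * (x * y) → z ≤ N * (x * y) :=
    fun hc hx hy hz => hz.trans (mul_le_mul_of_nonneg_right hc (mul_nonneg hx hy))
  have hle : ∀ {p q x y : ℝ}, 0 ≤ p → 0 ≤ q → p ≤ x → q ≤ y → N * (p * q) ≤ N * (x * y) :=
    fun hp hq hx hy => mul_le_mul_of_nonneg_left (mul_le_mul hx hy hq (hp.trans hx)) hN0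
  have e1 : ‖B * D‖ ≤ N * (β * ‖D‖) :=
    (hmul hnN (norm_nonneg _) (norm_nonneg _) (norm_matrix_mul_le B D)).trans
      (hle (norm_nonneg _) (norm_nonneg _) hB le_rfl)
  have e2 : ‖D * A‖ ≤ N * (‖D‖ * β) :=
    (hmul hmN (norm_nonneg _) (norm_nonneg _) (norm_matrix_mul_le D A)).trans
      (hle (norm_nonneg _) (norm_nonneg _) le_rfl hA)
  have e3 : ‖Q * D‖ ≤ N * (K * ‖D‖) :=
    (hmul hnN (norm_nonneg _) (norm_nonneg _) (norm_matrix_mul_le Q D)).trans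
      (hle (norm_nonneg _) (norm_nonneg _) hQ le_rfl)
  have e4 : ‖D * S‖ ≤ N * (‖D‖ * K) :=
    (hmul hmN (norm_nonneg _) (norm_nonneg _) (norm_matrix_mul_le D S)).trans
      (hle (norm_nonneg _) (norm_nonneg _) le_rfl hS)
  have e5' : ‖D * U‖ ≤ N * (‖D‖ * K) :=
    (hmul hmN (norm_nonneg _) (norm_nonneg _) (norm_matrix_mul_le D U)).trans
      (hle (norm_nonneg _) (norm_nonneg _) le_rfl hU)
  have e5 : ‖D * U * X‖ ≤ N * (N * (‖D‖ * K) * R) :=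
    (hmul hnN (norm_nonneg _) (norm_nonneg _) (norm_matrix_mul_le (D * U) X)).trans
      (hle (norm_nonneg _) (norm_nonneg _) e5' hX)
  have e6' : ‖Y * U‖ ≤ N * (R * K) :=
    (hmul hmN (norm_nonneg _) (norm_nonneg _) (norm_matrix_mul_le Y U)).trans
      (hle (norm_nonneg _) (norm_nonneg _) hY hU)
  have e6 : ‖Y * U * D‖ ≤ N * (N * (R * K) * ‖D‖) :=
    (hmul hnN (norm_nonneg _) (norm_nonneg _) (norm_matrix_mul_le (Y * U) D)).trans
      (hle (norm_nonneg _) (norm_nonneg _) e6' le_rfl)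
  have e7 : ‖(η : ℂ) • (Q * D - D * S)‖ ≤ η * (N * (K * ‖D‖) + N * (‖D‖ * K)) := by
    rw [norm_smul, Complex.norm_real, Real.norm_of_nonneg hη]
    exact mul_le_mul_of_nonneg_left ((norm_sub_le _ _).trans (add_le_add e3 e4)) hη
  have e8 : ‖((η : ℂ) ^ 2) • (D * U * X + Y * U * D)‖ ≤
      η ^ 2 * (N * (N * (‖D‖ * K) * R) + N * (N * (R * K) * ‖D‖)) := by
    rw [norm_smul, norm_pow, Complex.norm_real, Real.norm_of_nonneg hη]
    exact mul_le_mul_of_nonneg_left ((norm_add_le _ _).trans (add_le_add e5 e6)) (sq_nonneg _)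
  rw [hdiff]
  refine (norm_sub_add_sub_le e1 e2 e7 e8).trans_eq ?_
  ring

/-- Freezing the linear part at `z = 0` leaves a Sylvester operator, inverted by the uniform Green
operator, and a remainder made contracting by small `ρ` and `h`. The constants are chosen before the
coefficients, and every `ρ` up to `ρ₀` is allowed, so that two such equations can later share one
disk. -/
theorem exists_riccati_solution {m n : Type*} [Fintype m] [Fintype n] [DecidableEq m]
    [DecidableEq n] {r δ : ℝ} (hr : 0 < r) (hδ : 0 < δ) {K : ℝ} (hK : 0 ≤ K) :
    ∃ ρ₀ ∈ Ioc (0 : ℝ) r, ∃ h₁ > (0 : ℝ), ∃ R ≥ (0 : ℝ), ∀ ρ ∈ Ioc (0 : ℝ) ρ₀, ∀ h ∈ Ioo (0 : ℝ) h₁, ∀ η ∈ Icc (0 : ℝ) h,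
      ∀ (A S : ℂ → Matrix m m ℂ) (B Q : ℂ → Matrix n n ℂ) (P : ℂ → Matrix n m ℂ)
        (U : ℂ → Matrix m n ℂ),
      DifferentiableOn ℂ A (Metric.ball 0 r) → DifferentiableOn ℂ S (Metric.ball 0 r) →
      DifferentiableOn ℂ B (Metric.ball 0 r) → DifferentiableOn ℂ Q (Metric.ball 0 r) →
      DifferentiableOn ℂ P (Metric.ball 0 r) → DifferentiableOn ℂ U (Metric.ball 0 r) →
      (∀ z ∈ Metric.ball 0 r, ‖A z‖ ≤ K) → (∀ z ∈ Metric.ball 0 r, ‖S z‖ ≤ K) →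
      (∀ z ∈ Metric.ball 0 r, ‖B z‖ ≤ K) → (∀ z ∈ Metric.ball 0 r, ‖Q z‖ ≤ K) →
      (∀ z ∈ Metric.ball 0 r, ‖P z‖ ≤ K) → (∀ z ∈ Metric.ball 0 r, ‖U z‖ ≤ K) →
      (∀ a ∈ spectrum ℂ (A 0), ∀ b ∈ spectrum ℂ (B 0), δ ≤ ‖a - b‖) →
      ∃ y : ℂ → Matrix n m ℂ,
        (∀ z ∈ slitBall (ρ * Real.exp (-Real.pi)), ‖y z‖ ≤ R) ∧
        ContinuousWithinAt y (slitBall (ρ * Real.exp (-Real.pi))) 0 ∧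
        ∀ z ∈ slitBall (ρ * Real.exp (-Real.pi)), ∃ y' : Matrix n m ℂ,
          (∀ i j, HasDerivAt (fun x => y x i j) (y' i j) z) ∧ (z * (h : ℂ)) • y' =
          B z * y z - y z * A z + P z + (η : ℂ) • (Q z * y z - y z * S z) -
            ((η : ℂ) ^ 2) • (y z * U z * y z) := by
  set N : ℝ := Fintype.card m + Fintype.card n with hN
  have hN0 : 0 ≤ N := by positivity
  obtain ⟨Γ, hΓ, hgreen⟩ := exists_uniform_green (Matrix n m ℂ) hδ (N * K)
  set R := 2 * Γ * K with hR
  have hR0 : 0 ≤ R := by positivity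
  set a := N * K with ha
  have ha0 : 0 ≤ a := by positivity
  set b := a + R * N * a with hb
  have hb0 : 0 ≤ b := by positivity
  have hden : 0 < 1 + 16 * Γ * a := by positivity
  -- The radius makes the contribution of `B - B(0)` and `A - A(0)` to the contraction factor at
  -- most `1 / 4`; the bound on `h` makes that of the terms in `η` at most `1 / 8`.
  refine ⟨r / (1 + 16 * Γ * a), ⟨by positivity, div_le_self hr.le (by nlinarith [mul_nonneg hΓ.le ha0])⟩,
    1 / (1 + 16 * Γ * b), by positivity, R, hR0, ?_⟩
  intro ρ hρ h hh η hη A S B Q P U hA hS hB hQ hP hU hAK hSK hBK hQK hPK hUK hsep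
  have hρr : ρ ≤ r := hρ.2.trans (div_le_self hr.le (by nlinarith [mul_nonneg hΓ.le ha0]))
  have hh1 : h ≤ 1 := hh.2.le.trans (by
    rw [div_le_one (by positivity)]
    nlinarith [mul_nonneg hΓ.le hb0])
  set L := sylvesterMap (A 0) (B 0) with hL
  have hLapp : ∀ Y, L Y = B 0 * Y - Y * A 0 := fun Y => rfl
  have h0r : (0 : ℂ) ∈ Metric.ball (0 : ℂ) r := Metric.mem_ball_self hr
  have hLn : ∀ Y, ‖L Y‖ ≤ N * K * ‖Y‖ := by
    intro Y
    refine (norm_sub_le _ _).trans ((add_le_add (norm_matrix_mul_le _ _)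
      (norm_matrix_mul_le _ _)).trans ?_)
    have h1 := mul_le_mul_of_nonneg_right (hBK 0 h0r) (norm_nonneg Y)
    have h2 := mul_le_mul_of_nonneg_left (hAK 0 h0r) (norm_nonneg Y)
    calc _ ≤ (Fintype.card n : ℝ) * (K * ‖Y‖) + Fintype.card m * (‖Y‖ * K) := by gcongr
      _ = N * K * ‖Y‖ := by rw [hN]; ring
  obtain ⟨κ, hκ1, G, hG⟩ := hgreen L hLn (fun l hl => by
    obtain ⟨Y, hY⟩ := hl.exists_hasEigenvector
    obtain ⟨x, hx, x', hx', rfl⟩ := exists_sub_of_sylvester_eigenvalue hY.2 hY.apply_eq_smul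
    rw [norm_sub_rev]
    exact hsep x hx x' hx') h hh.1
  have hκ0 : 0 < κ := by linarith
  set ζ : ℂ → ℂ := fun w => ρ * Complex.exp (-w) with hζ
  have hζlt : ∀ w ∈ cone κ, ‖ζ w‖ < ρ := fun w hw => norm_mul_exp_neg_lt hκ0 hρ.1 hw
  have hζr : ∀ w ∈ cone κ, ζ w ∈ Metric.ball (0 : ℂ) r := fun w hw => by
    rw [mem_ball_zero_iff]; exact (hζlt w hw).trans_le hρr
  set β := 2 * K / r * ρ with hβ
  have hβ0 : 0 ≤ β := by have := hρ.1; positivity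
  have hBβ : ∀ w ∈ cone κ, ‖B (ζ w) - B 0‖ ≤ β := fun w hw =>
    (norm_sub_apply_zero_le hB hBK (hζr w hw)).trans
      (mul_le_mul_of_nonneg_left (hζlt w hw).le (by positivity))
  have hAβ : ∀ w ∈ cone κ, ‖A (ζ w) - A 0‖ ≤ β := fun w hw =>
    (norm_sub_apply_zero_le hA hAK (hζr w hw)).trans
      (mul_le_mul_of_nonneg_left (hζlt w hw).le (by positivity))
  set F : ℂ → Matrix n m ℂ → Matrix n m ℂ := fun w Y =>
    (B (ζ w) - B 0) * Y - Y * (A (ζ w) - A 0) + P (ζ w) +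
      (η : ℂ) • (Q (ζ w) * Y - Y * S (ζ w)) - ((η : ℂ) ^ 2) • (Y * U (ζ w) * Y) with hF
  have hη1 : η ≤ 1 := hη.2.trans hh1
  have hΓε : Γ * (2 * (N * β) + η * (2 * (N * K)) + η ^ 2 * (2 * (N * (N * (R * K))))) ≤
      1 / 2 := by
    have h1 : Γ * (2 * (N * β)) ≤ 1 / 4 := by
      have h2 : ρ * (1 + 16 * Γ * a) ≤ r := (le_div_iff₀ hden).1 hρ.2
      have h3 : Γ * (2 * (N * β)) = 4 * (Γ * a * ρ) / r := by rw [hβ, ha]; field_simp; ring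
      rw [h3, div_le_iff₀ hr]
      linarith [hρ.1]
    have h4 : η * (2 * (N * K)) + η ^ 2 * (2 * (N * (N * (R * K)))) ≤ h * (2 * b) := by
      have h5 : 0 ≤ 2 * (N * (N * (R * K))) := by positivity
      have h6 : η ^ 2 ≤ η := by nlinarith [hη.1]
      calc _ ≤ η * (2 * (N * K)) + η * (2 * (N * (N * (R * K)))) := by gcongr
        _ = η * (2 * b) := by rw [hb, ha]; ring
        _ ≤ h * (2 * b) := mul_le_mul_of_nonneg_right hη.2 (by positivity)
    have h7 : h * (1 + 16 * Γ * b) ≤ 1 := by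
      have := hh.2.le
      rwa [le_div_iff₀ (by positivity)] at this
    have h8 := mul_le_mul_of_nonneg_left h4 hΓ.le
    nlinarith [hh.1]
  have hlip : ∀ w ∈ cone κ, ∀ X Y : Matrix n m ℂ, ‖X‖ ≤ R → ‖Y‖ ≤ R → ‖F w X - F w Y‖ ≤
      (2 * (N * β) + η * (2 * (N * K)) + η ^ 2 * (2 * (N * (N * (R * K))))) * ‖X - Y‖ :=
    fun w hw X Y hX hY => norm_riccati_sub_le hη.1 (hBβ w hw) (hAβ w hw) (hQK _ (hζr w hw))
      (hSK _ (hζr w hw)) (hUK _ (hζr w hw)) hX hY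
  obtain ⟨y, hyadm, hyR, hyder⟩ := hG.exists_solution hκ0 (F := F) (R := R) (M := K)
    (ε := 2 * (N * β) + η * (2 * (N * K)) + η ^ 2 * (2 * (N * (N * (R * K))))) hR0
    hΓε (by rw [hR]; apply le_of_eq; ring) (by
      intro y hy
      have h1 := ((ConeAdm.comp_exp hκ0 hρ.1 hρr hB hBK).sub (ConeAdm.const κ (B 0))).matrix_mul hy
      have h2 := hy.matrix_mul ((ConeAdm.comp_exp hκ0 hρ.1 hρr hA hAK).sub (ConeAdm.const κ (A 0)))
      have h3 := (((ConeAdm.comp_exp hκ0 hρ.1 hρr hQ hQK).matrix_mul hy).sub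
        (hy.matrix_mul (ConeAdm.comp_exp hκ0 hρ.1 hρr hS hSK))).const_smul (η : ℂ)
      have h4 := ((hy.matrix_mul (ConeAdm.comp_exp hκ0 hρ.1 hρr hU hUK)).matrix_mul hy).const_smul ((η : ℂ) ^ 2)
      exact (((h1.sub h2).add (ConeAdm.comp_exp hκ0 hρ.1 hρr hP hPK)).add h3).sub h4)
    hlip (by have := hη.1; positivity) (fun w hw => by simpa [hF] using hPK _ (hζr w hw))
  obtain ⟨l, hl⟩ := hyadm.lim
  set τ : ℂ → ℂ := fun z => (Real.log ρ : ℂ) - Complex.log z with hτ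
  set Ω := slitBall (ρ * Real.exp (-Real.pi)) with hΩ
  have hne : ∀ z ∈ Ω, z ≠ 0 := fun z hz => Complex.slitPlane_ne_zero hz.2
  have hτmem : ∀ z ∈ Ω, τ z ∈ cone κ := fun z hz => log_sub_log_mem_cone hκ1 hρ.1 hz
  have hζτ : ∀ z ∈ Ω, ζ (τ z) = z := fun z hz => mul_exp_neg_log_sub_log hρ.1 (hne z hz)
  -- At `0` the composite takes a meaningless value, since `Complex.log 0 = 0`. It is replaced by
  -- the limit at infinity; `0` is not in the slit disk, so the equation is unaffected.
  set v : ℂ → Matrix n m ℂ := Function.update (fun z => y (τ z)) 0 l with hv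
  have hveq : ∀ z ∈ Ω, v z = y (τ z) := fun z hz => Function.update_of_ne (hne z hz) _ _
  have hder : ∀ z ∈ Ω, HasDerivAt v
      ((-z⁻¹) • (-((h : ℂ)⁻¹ • (L (y (τ z)) + F (τ z) (y (τ z)))))) z := by
    intro z hz
    have h1 : HasDerivAt τ (-z⁻¹) z := (Complex.hasDerivAt_log hz.2).const_sub _
    refine ((hyder (τ z) (hτmem z hz)).scomp z h1).congr_of_eventuallyEq ?_
    filter_upwards [(isOpen_slitBall _).mem_nhds hz] with x hx using hveq x hx
  refine ⟨v, fun z hz => (hveq z hz).symm ▸ hyR _ (hτmem z hz), ?_, fun z hz => ?_⟩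
  · unfold ContinuousWithinAt
    rw [show v 0 = l from Function.update_self _ _ _]
    refine (hl.comp (tendsto_log_sub_log hκ1 hρ.1)).congr' ?_
    filter_upwards [self_mem_nhdsWithin] with z hz using (hveq z hz).symm
  · have hh0 : (h : ℂ) ≠ 0 := Complex.ofReal_ne_zero.2 hh.1.ne'
    have hz0 := hne z hz
    refine ⟨_, fun i j => hasDerivAt_pi.1 (hasDerivAt_pi.1 (hder z hz) i) j, ?_⟩
    rw [hveq z hz, smul_neg, neg_smul, neg_neg, smul_smul, smul_smul,
      show z * (h : ℂ) * z⁻¹ * (h : ℂ)⁻¹ = 1 by field_simp, one_smul, hLapp]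
    simp only [hF, hζτ z hz, Matrix.sub_mul, Matrix.mul_sub]
    abel

/-- Entrywise form of `exists_riccati_solution`. -/
theorem exists_riccati_solution_entrywise (m n : Type*) [Fintype m] [Fintype n] [DecidableEq m]
    [DecidableEq n] {r δ : ℝ} (hr : 0 < r) (hδ : 0 < δ) {K : ℝ} (hK : 0 ≤ K) :
    ∃ ρ₀ ∈ Ioc (0 : ℝ) r, ∃ h₁ > (0 : ℝ), ∃ R ≥ (0 : ℝ), ∀ ρ ∈ Ioc (0 : ℝ) ρ₀,
      ∀ h ∈ Ioo (0 : ℝ) h₁, ∀ η ∈ Icc (0 : ℝ) h,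
      ∀ (A S : ℂ → Matrix m m ℂ) (B Q : ℂ → Matrix n n ℂ) (P : ℂ → Matrix n m ℂ)
        (U : ℂ → Matrix m n ℂ),
      (∀ i j, DifferentiableOn ℂ (fun z => A z i j) (Metric.ball 0 r)) →
      (∀ i j, DifferentiableOn ℂ (fun z => S z i j) (Metric.ball 0 r)) →
      (∀ i j, DifferentiableOn ℂ (fun z => B z i j) (Metric.ball 0 r)) →
      (∀ i j, DifferentiableOn ℂ (fun z => Q z i j) (Metric.ball 0 r)) →
      (∀ i j, DifferentiableOn ℂ (fun z => P z i j) (Metric.ball 0 r)) →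
      (∀ i j, DifferentiableOn ℂ (fun z => U z i j) (Metric.ball 0 r)) →
      (∀ z ∈ Metric.ball 0 r, ∀ i j, ‖A z i j‖ ≤ K) →
      (∀ z ∈ Metric.ball 0 r, ∀ i j, ‖S z i j‖ ≤ K) →
      (∀ z ∈ Metric.ball 0 r, ∀ i j, ‖B z i j‖ ≤ K) →
      (∀ z ∈ Metric.ball 0 r, ∀ i j, ‖Q z i j‖ ≤ K) →
      (∀ z ∈ Metric.ball 0 r, ∀ i j, ‖P z i j‖ ≤ K) →
      (∀ z ∈ Metric.ball 0 r, ∀ i j, ‖U z i j‖ ≤ K) →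
      (∀ a ∈ spectrum ℂ (A 0), ∀ b ∈ spectrum ℂ (B 0), δ ≤ ‖a - b‖) →
      ∃ y : ℂ → Matrix n m ℂ,
        (∀ z ∈ slitBall (ρ * Real.exp (-Real.pi)), ∀ i j, ‖y z i j‖ ≤ R) ∧
        (∀ i j, ContinuousWithinAt (fun z => y z i j) (slitBall (ρ * Real.exp (-Real.pi))) 0) ∧
        ∀ z ∈ slitBall (ρ * Real.exp (-Real.pi)), ∃ y' : Matrix n m ℂ,
          (∀ i j, HasDerivAt (fun x => y x i j) (y' i j) z) ∧ (z * (h : ℂ)) • y' =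
          B z * y z - y z * A z + P z + (η : ℂ) • (Q z * y z - y z * S z) -
            ((η : ℂ) ^ 2) • (y z * U z * y z) := by
  obtain ⟨ρ₀, hρ₀, h₁, hh₁, R, hR, H⟩ := exists_riccati_solution (m := m) (n := n) hr hδ hK
  refine ⟨ρ₀, hρ₀, h₁, hh₁, R, hR, ?_⟩
  intro ρ hρ h hh η hη A S B Q P U hA hS hB hQ hP hU hAK hSK hBK hQK hPK hUK hsep
  obtain ⟨y, h1, h2, h3⟩ := H ρ hρ h hh η hη A S B Q P U (differentiableOn_matrix.2 hA)
    (differentiableOn_matrix.2 hS) (differentiableOn_matrix.2 hB) (differentiableOn_matrix.2 hQ)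
    (differentiableOn_matrix.2 hP) (differentiableOn_matrix.2 hU)
    (fun z hz => (Matrix.norm_le_iff hK).2 (hAK z hz))
    (fun z hz => (Matrix.norm_le_iff hK).2 (hSK z hz))
    (fun z hz => (Matrix.norm_le_iff hK).2 (hBK z hz))
    (fun z hz => (Matrix.norm_le_iff hK).2 (hQK z hz))
    (fun z hz => (Matrix.norm_le_iff hK).2 (hPK z hz))
    (fun z hz => (Matrix.norm_le_iff hK).2 (hUK z hz)) hsep
  exact ⟨y, fun z hz => (Matrix.norm_le_iff hR).1 (h1 z hz),
    fun i j => tendsto_pi_nhds.1 (tendsto_pi_nhds.1 h2 i) j, h3⟩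

/-- `M` is strictly diagonally dominant, hence invertible. The identity `M⁻¹ = 1 - (M - 1) * M⁻¹`
gives `‖M⁻¹‖ ≤ 1 + ‖M⁻¹‖ / 2`. -/
theorem norm_inv_entry_le {k : Type*} [Fintype k] [DecidableEq k] {M : Matrix k k ℂ} {e : ℝ}
    (he : Fintype.card k * e ≤ 1 / 2) (hM : ∀ i j, ‖M i j - (1 : Matrix k k ℂ) i j‖ ≤ e) :
    IsUnit M ∧ ∀ i j, ‖M⁻¹ i j‖ ≤ 2 := by
  have hdet : M.det ≠ 0 := by
    refine det_ne_zero_of_sum_row_lt_diag fun i => ?_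
    have h1 : ∑ j ∈ Finset.univ.erase i, ‖M i j‖ + ‖M i i - 1‖ ≤ 1 / 2 := by
      calc _ = ∑ j ∈ Finset.univ.erase i, ‖M i j - (1 : Matrix k k ℂ) i j‖ +
            ‖M i i - (1 : Matrix k k ℂ) i i‖ := by
            rw [Matrix.one_apply_eq]
            congr 1
            refine Finset.sum_congr rfl fun j hj => ?_
            rw [Matrix.one_apply_ne (Finset.ne_of_mem_erase hj).symm, sub_zero]
        _ = ∑ j, ‖M i j - (1 : Matrix k k ℂ) i j‖ :=
            Finset.sum_erase_add _ _ (Finset.mem_univ i)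
        _ ≤ ∑ _j : k, e := Finset.sum_le_sum fun j _ => hM i j
        _ ≤ 1 / 2 := by simpa using he
    have h2 : 1 - ‖M i i - 1‖ ≤ ‖M i i‖ := by
      have := norm_sub_norm_le (1 : ℂ) (1 - M i i)
      rw [norm_one, norm_sub_rev 1 (M i i), sub_sub_cancel] at this
      exact this
    linarith
  have hu : IsUnit M := (Matrix.isUnit_iff_isUnit_det M).2 (isUnit_iff_ne_zero.2 hdet)
  refine ⟨hu, ?_⟩
  rcases isEmpty_or_nonempty k with hk | ⟨⟨i₀⟩⟩
  · exact fun i => (hk.false i).elim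
  have he0 : 0 ≤ e := (norm_nonneg _).trans (hM i₀ i₀)
  rw [← Matrix.norm_le_iff zero_le_two]
  have hM1 : ‖M - 1‖ ≤ e := (Matrix.norm_le_iff he0).2 hM
  have h1 : ‖(1 : Matrix k k ℂ)‖ ≤ 1 := (Matrix.norm_le_iff zero_le_one).2 fun i j => by
    rw [Matrix.one_apply]; split_ifs <;> simp
  have h2 : M⁻¹ = 1 - (M - 1) * M⁻¹ := by
    rw [Matrix.sub_mul, Matrix.mul_nonsing_inv _ (isUnit_iff_ne_zero.2 hdet), Matrix.one_mul,
      sub_sub_cancel]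
  have h3 : ‖(M - 1) * M⁻¹‖ ≤ 1 / 2 * ‖M⁻¹‖ := by
    refine (norm_matrix_mul_le _ _).trans ?_
    rw [← mul_assoc]
    refine mul_le_mul_of_nonneg_right (le_trans ?_ he) (norm_nonneg _)
    exact mul_le_mul_of_nonneg_left hM1 (by positivity)
  have h4 : ‖M⁻¹‖ ≤ ‖(1 : Matrix k k ℂ)‖ + ‖(M - 1) * M⁻¹‖ := by
    nth_rewrite 1 [h2]
    exact norm_sub_le _ _
  linarith

end Riccati

/-! ### Conjugation of linear systems -/

section Conjugation

theorem differentiableAt_det {k : Type*} [Fintype k] [DecidableEq k] {M : ℂ → Matrix k k ℂ}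
    {z : ℂ} (hM : ∀ i j, DifferentiableAt ℂ (fun x => M x i j) z) :
    DifferentiableAt ℂ (fun x => (M x).det) z := by
  simp only [Matrix.det_apply]
  exact DifferentiableAt.fun_sum fun σ _ => DifferentiableAt.const_smul
    (DifferentiableAt.fun_finsetProd fun i _ => hM _ _) _

theorem differentiableAt_inv_entry {k : Type*} [Fintype k] [DecidableEq k]
    {M : ℂ → Matrix k k ℂ} {z : ℂ} (hM : ∀ i j, DifferentiableAt ℂ (fun x => M x i j) z)
    (hu : IsUnit (M z)) (i j : k) : DifferentiableAt ℂ (fun x => (M x)⁻¹ i j) z := by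
  have hdet : (M z).det ≠ 0 := isUnit_iff_ne_zero.1 ((Matrix.isUnit_iff_isUnit_det _).1 hu)
  simp only [Matrix.inv_def, Matrix.smul_apply, Ring.inverse_eq_inv', smul_eq_mul,
    Matrix.adjugate_apply]
  refine ((differentiableAt_det hM).inv hdet).mul (differentiableAt_det fun a b => ?_)
  simp only [Matrix.updateRow_apply]
  split_ifs
  · exact differentiableAt_const _
  · exact hM a b

theorem hasDerivAt_mulVec {k : Type*} [Fintype k] {M : ℂ → Matrix k k ℂ} {M' : Matrix k k ℂ}
    {Z : ℂ → k → ℂ} {Z' : k → ℂ} {z : ℂ} (hM : ∀ i j, HasDerivAt (fun x => M x i j) (M' i j) z)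
    (hZ : HasDerivAt Z Z' z) :
    HasDerivAt (fun x => M x *ᵥ Z x) (M' *ᵥ Z z + M z *ᵥ Z') z := by
  rw [hasDerivAt_pi] at hZ ⊢
  intro i
  simp only [Matrix.mulVec, dotProduct, Pi.add_apply, ← Finset.sum_add_distrib]
  exact HasDerivAt.fun_sum fun j _ => (hM i j).mul (hZ j)

/-- A matrix solution `T` of `z h T' = A T - T D` transforms the solutions of `z h Z' = D Z` into
those of `z h W' = A W`. -/
theorem isSolutionOn_mulVec_iff {k : Type*} [Fintype k] [DecidableEq k] {h : ℝ}
    {A T D : ℂ → Matrix k k ℂ} {U : Set ℂ} (hU : IsOpen U) (hu : ∀ z ∈ U, IsUnit (T z))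
    (hT : ∀ z ∈ U, ∃ T' : Matrix k k ℂ, (∀ i j, HasDerivAt (fun x => T x i j) (T' i j) z) ∧
      (z * (h : ℂ)) • T' = A z * T z - T z * D z) (Z : ℂ → k → ℂ) :
    IsSolutionOn U h D Z ↔ IsSolutionOn U h A (fun z => T z *ᵥ Z z) := by
  have key : ∀ z ∈ U, DifferentiableAt ℂ Z z →
      DifferentiableAt ℂ (fun x => T x *ᵥ Z x) z ∧
        (z * (h : ℂ)) • deriv (fun x => T x *ᵥ Z x) z =
          A z *ᵥ (T z *ᵥ Z z) + T z *ᵥ ((z * (h : ℂ)) • deriv Z z - D z *ᵥ Z z) := by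
    intro z hz hZ
    obtain ⟨T', hT', hTeq⟩ := hT z hz
    have hd := hasDerivAt_mulVec hT' hZ.hasDerivAt
    refine ⟨hd.differentiableAt, ?_⟩
    rw [hd.deriv, smul_add, ← Matrix.smul_mulVec, hTeq, Matrix.sub_mulVec, Matrix.mulVec_sub,
      Matrix.mulVec_smul, ← Matrix.mulVec_mulVec, ← Matrix.mulVec_mulVec]
    abel
  constructor
  · intro hZ z hz
    obtain ⟨h1, h2⟩ := hZ z hz
    obtain ⟨h3, h4⟩ := key z hz h1
    refine ⟨h3, ?_⟩
    rw [h4, h2, sub_self, Matrix.mulVec_zero, add_zero]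
  · intro hW z hz
    have hdet : ∀ x ∈ U, IsUnit (T x).det := fun x hx =>
      (Matrix.isUnit_iff_isUnit_det _).1 (hu x hx)
    have hinv : ∀ x ∈ U, ∀ v, (T x)⁻¹ *ᵥ (T x *ᵥ v) = v := fun x hx v => by
      rw [Matrix.mulVec_mulVec, Matrix.nonsing_inv_mul _ (hdet x hx), Matrix.one_mulVec]
    obtain ⟨h1, h2⟩ := hW z hz
    -- Differentiability of `Z` is not assumed here; it is recovered from `Z = T⁻¹ (T Z)`.
    have hZ : DifferentiableAt ℂ Z z := by
      obtain ⟨T', hT', -⟩ := hT z hz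
      have hd := hasDerivAt_mulVec (M := fun x => (T x)⁻¹)
        (M' := fun i j => deriv (fun x => (T x)⁻¹ i j) z)
        (fun i j => (differentiableAt_inv_entry (fun i j => (hT' i j).differentiableAt)
          (hu z hz) i j).hasDerivAt) h1.hasDerivAt
      refine hd.differentiableAt.congr_of_eventuallyEq ?_
      filter_upwards [hU.mem_nhds hz] with x hx using (hinv x hx _).symm
    refine ⟨hZ, ?_⟩
    have h4 := (key z hz hZ).2
    rw [h2, left_eq_add] at h4
    have h5 := hinv z hz ((z * (h : ℂ)) • deriv Z z - D z *ᵥ Z z)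
    rw [h4, Matrix.mulVec_zero] at h5
    exact sub_eq_zero.1 h5.symm

end Conjugation

/-! ### Assembly of the conjugator -/

theorem DifferentiableOn.matrix_mul_entry {a b c : Type*} [Fintype b] {M : ℂ → Matrix a b ℂ}
    {N : ℂ → Matrix b c ℂ} {U : Set ℂ} (hM : ∀ i j, DifferentiableOn ℂ (fun z => M z i j) U)
    (hN : ∀ i j, DifferentiableOn ℂ (fun z => N z i j) U) (i : a) (j : c) :
    DifferentiableOn ℂ (fun z => (M z * N z) i j) U := by
  simp only [Matrix.mul_apply]
  exact DifferentiableOn.fun_sum fun k _ => (hM i k).mul (hN k j)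

theorem corollary1p4 {m n : Type*} [Fintype m] [Fintype n] [DecidableEq m] [DecidableEq n]
    (r h₀ p : ℝ) (hr : 0 < r) (hh₀ : 0 < h₀) (hp : 1 ≤ p)
    (A₁₁ : ℂ → ℝ → Matrix m m ℂ) (A₂₂ : ℂ → ℝ → Matrix n n ℂ)
    (Θ : ℂ → ℝ → Matrix (m ⊕ n) (m ⊕ n) ℂ)
    -- analyticity in `z` on the disk
    (hA₁₁ : ∀ h ∈ Set.Ioo 0 h₀, MatAnalyticOn (fun z => A₁₁ z h) (Metric.ball 0 r))
    (hA₂₂ : ∀ h ∈ Set.Ioo 0 h₀, MatAnalyticOn (fun z => A₂₂ z h) (Metric.ball 0 r))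
    (hΘ : ∀ h ∈ Set.Ioo 0 h₀, MatAnalyticOn (fun z => Θ z h) (Metric.ball 0 r))
    -- continuity in `h`
    (hcA₁₁ : ∀ z ∈ Metric.ball (0 : ℂ) r, ContinuousOn (fun h => A₁₁ z h) (Set.Ioo 0 h₀))
    (hcA₂₂ : ∀ z ∈ Metric.ball (0 : ℂ) r, ContinuousOn (fun h => A₂₂ z h) (Set.Ioo 0 h₀))
    (hcΘ : ∀ z ∈ Metric.ball (0 : ℂ) r, ContinuousOn (fun h => Θ z h) (Set.Ioo 0 h₀))
    -- the coefficients are bounded uniformly in `z` and `h`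
    (K : ℝ)
    (hbA₁₁ : ∀ z ∈ Metric.ball (0 : ℂ) r, ∀ h ∈ Set.Ioo 0 h₀, ∀ i j, ‖A₁₁ z h i j‖ ≤ K)
    (hbA₂₂ : ∀ z ∈ Metric.ball (0 : ℂ) r, ∀ h ∈ Set.Ioo 0 h₀, ∀ i j, ‖A₂₂ z h i j‖ ≤ K)
    (hbΘ : ∀ z ∈ Metric.ball (0 : ℂ) r, ∀ h ∈ Set.Ioo 0 h₀, ∀ i j, ‖Θ z h i j‖ ≤ K)
    -- `A₁₁(0)` and `A₂₂(0)` have no eigenvalue in common, uniformly in `h`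
    (δ : ℝ) (hδ : 0 < δ)
    (hsep : ∀ h ∈ Set.Ioo 0 h₀, ∀ a ∈ spectrum ℂ (A₁₁ 0 h), ∀ b ∈ spectrum ℂ (A₂₂ 0 h),
      δ ≤ ‖a - b‖) :
    ∃ ρ ∈ Set.Ioc 0 r, ∃ h₁ ∈ Set.Ioc 0 h₀, ∃ C : ℝ,
      ∃ T : ℂ → ℝ → Matrix (m ⊕ n) (m ⊕ n) ℂ, ∀ h ∈ Set.Ioo 0 h₁,
        IsBlockDiagonalizingConjugator (slitBall ρ) h (fullCoeff A₁₁ A₂₂ Θ p h)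
          (fun z => T z h) ∧
        (∀ z ∈ slitBall ρ, ∀ i j, ‖T z h i j‖ ≤ C) ∧
        (∀ z ∈ slitBall ρ, ∀ i j, ‖(T z h)⁻¹ i j‖ ≤ C) ∧
        (∀ z ∈ slitBall ρ, ∀ i j,
          ‖T z h i j - (1 : Matrix (m ⊕ n) (m ⊕ n) ℂ) i j‖ ≤ C * h ^ p) ∧
        ContinuousWithinAt (fun z => T z h) (slitBall ρ) 0 := by
  have hK' : 0 ≤ max K 0 := le_max_right _ _
  have hKK : K ≤ max K 0 := le_max_left _ _
  obtain ⟨ρ₁, hρ₁, k₁, hk₁, R₁, hR₁, H₁⟩ := exists_riccati_solution_entrywise m n hr hδ hK'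
  obtain ⟨ρ₂, hρ₂, k₂, hk₂, R₂, hR₂, H₂⟩ := exists_riccati_solution_entrywise n m hr hδ hK'
  set R := max R₁ R₂ with hR
  have hR0 : 0 ≤ R := hR₁.trans (le_max_left _ _)
  set N : ℝ := ((Fintype.card (m ⊕ n) : ℕ) : ℝ) with hN
  have hN0 : 0 ≤ N := by positivity
  set ρ₀ := min ρ₁ ρ₂ with hρ₀
  have hρ₀pos : 0 < ρ₀ := lt_min hρ₁.1 hρ₂.1
  set ρ := ρ₀ * Real.exp (-Real.pi) with hρ
  have hρpos : 0 < ρ := by positivity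
  have hρr : ρ ≤ r := by
    have h1 : Real.exp (-Real.pi) ≤ 1 := Real.exp_le_one_iff.2 (by linarith [Real.pi_pos])
    exact (mul_le_of_le_one_right hρ₀pos.le h1).trans ((min_le_left _ _).trans hρ₁.2)
  have hΩr : slitBall ρ ⊆ Metric.ball 0 r := fun z hz => Metric.ball_subset_ball hρr hz.1
  -- The last term ensures `h ≤ 1`, hence `h ^ p ≤ h` as `p ≥ 1`, and makes `T` close enough to the
  -- identity for `norm_inv_entry_le`.
  set h₁ := min h₀ (min (min k₁ k₂) (1 / (2 * ((N + 1) * R + 1)))) with hh₁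
  have hh₁pos : 0 < h₁ := by positivity
  refine ⟨ρ, ⟨hρpos, hρr⟩, h₁, ⟨hh₁pos, min_le_left _ _⟩, R + 2, ?_⟩
  suffices hmain : ∀ h ∈ Ioo 0 h₁, ∃ T : ℂ → Matrix (m ⊕ n) (m ⊕ n) ℂ,
      IsBlockDiagonalizingConjugator (slitBall ρ) h (fullCoeff A₁₁ A₂₂ Θ p h) T ∧
        (∀ z ∈ slitBall ρ, ∀ i j, ‖T z i j‖ ≤ R + 2) ∧
        (∀ z ∈ slitBall ρ, ∀ i j, ‖(T z)⁻¹ i j‖ ≤ R + 2) ∧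
        (∀ z ∈ slitBall ρ, ∀ i j,
          ‖T z i j - (1 : Matrix (m ⊕ n) (m ⊕ n) ℂ) i j‖ ≤ (R + 2) * h ^ p) ∧
        ContinuousWithinAt T (slitBall ρ) 0 by
    choose! T hT using hmain
    exact ⟨fun z h => T h z, hT⟩
  intro h hh
  have hpos : 0 < h := hh.1
  have hhh₀ : h ∈ Ioo 0 h₀ := ⟨hh.1, hh.2.trans_le (min_le_left _ _)⟩
  have hlt : h < min (min k₁ k₂) (1 / (2 * ((N + 1) * R + 1))) :=
    hh.2.trans_le (min_le_right _ _)
  have hhk₁ : h ∈ Ioo 0 k₁ := ⟨hh.1, hlt.trans_le ((min_le_left _ _).trans (min_le_left _ _))⟩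
  have hhk₂ : h ∈ Ioo 0 k₂ := ⟨hh.1, hlt.trans_le ((min_le_left _ _).trans (min_le_right _ _))⟩
  have hsmall : h * (2 * ((N + 1) * R + 1)) ≤ 1 := by
    have := (hlt.trans_le (min_le_right _ _)).le
    rwa [le_div_iff₀ (by positivity)] at this
  have hNR : 0 ≤ (N + 1) * R := by positivity
  have hh1 : h ≤ 1 := by nlinarith
  set η := h ^ p with hη
  have hη0 : 0 ≤ η := by positivity
  have hηh : η ≤ h := by
    simpa using Real.rpow_le_rpow_of_exponent_ge hpos hh1 hp
  have hηI : η ∈ Icc 0 h := ⟨hη0, hηh⟩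
  have hηR : (N + 1) * (η * R) ≤ 1 / 2 := by nlinarith [mul_le_mul_of_nonneg_right hηh hNR]
  have dA₁ := fun i j => ((hA₁₁ h hhh₀) i j).differentiableOn
  have dA₂ := fun i j => ((hA₂₂ h hhh₀) i j).differentiableOn
  have dΘ := fun i j => ((hΘ h hhh₀) i j).differentiableOn
  have bΘ := fun z hz i j => (hbΘ z hz h hhh₀ i j).trans hKK
  obtain ⟨y, hyR, hyc, hy⟩ := H₁ ρ₀ ⟨hρ₀pos, min_le_left _ _⟩ h hhk₁ η hηI
    (fun z => A₁₁ z h) (fun z => (Θ z h).toBlocks₁₁) (fun z => A₂₂ z h)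
    (fun z => (Θ z h).toBlocks₂₂) (fun z => (Θ z h).toBlocks₂₁) (fun z => (Θ z h).toBlocks₁₂)
    dA₁ (fun i j => dΘ _ _) dA₂ (fun i j => dΘ _ _) (fun i j => dΘ _ _) (fun i j => dΘ _ _)
    (fun z hz i j => (hbA₁₁ z hz h hhh₀ i j).trans hKK) (fun z hz i j => bΘ z hz _ _)
    (fun z hz i j => (hbA₂₂ z hz h hhh₀ i j).trans hKK) (fun z hz i j => bΘ z hz _ _)
    (fun z hz i j => bΘ z hz _ _) (fun z hz i j => bΘ z hz _ _) (hsep h hhh₀)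
  -- The other off-diagonal block solves the same equation with the two diagonal blocks exchanged,
  -- on the same disk.
  obtain ⟨x, hxR, hxc, hx⟩ := H₂ ρ₀ ⟨hρ₀pos, min_le_right _ _⟩ h hhk₂ η hηI
    (fun z => A₂₂ z h) (fun z => (Θ z h).toBlocks₂₂) (fun z => A₁₁ z h)
    (fun z => (Θ z h).toBlocks₁₁) (fun z => (Θ z h).toBlocks₁₂) (fun z => (Θ z h).toBlocks₂₁)
    dA₂ (fun i j => dΘ _ _) dA₁ (fun i j => dΘ _ _) (fun i j => dΘ _ _) (fun i j => dΘ _ _)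
    (fun z hz i j => (hbA₂₂ z hz h hhh₀ i j).trans hKK) (fun z hz i j => bΘ z hz _ _)
    (fun z hz i j => (hbA₁₁ z hz h hhh₀ i j).trans hKK) (fun z hz i j => bΘ z hz _ _)
    (fun z hz i j => bΘ z hz _ _) (fun z hz i j => bΘ z hz _ _)
    (fun b hb a ha => norm_sub_rev a b ▸ hsep h hhh₀ a ha b hb)
  set T : ℂ → Matrix (m ⊕ n) (m ⊕ n) ℂ := fun z =>
    Matrix.fromBlocks 1 ((η : ℂ) • x z) ((η : ℂ) • y z) 1 with hT
  have hTone : ∀ z ∈ slitBall ρ, ∀ i j,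
      ‖T z i j - (1 : Matrix (m ⊕ n) (m ⊕ n) ℂ) i j‖ ≤ η * R := by
    intro z hz i j
    have hηR0 : 0 ≤ η * R := by positivity
    rw [← Matrix.fromBlocks_one]
    rcases i with i | i <;> rcases j with j | j
    · simpa [hT] using hηR0
    · simp only [hT, Matrix.fromBlocks_apply₁₂, Matrix.smul_apply, Matrix.zero_apply, sub_zero,
        norm_smul, Complex.norm_real, Real.norm_of_nonneg hη0]
      exact mul_le_mul_of_nonneg_left ((hxR z hz i j).trans (le_max_right _ _)) hη0
    · simp only [hT, Matrix.fromBlocks_apply₂₁, Matrix.smul_apply, Matrix.zero_apply, sub_zero,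
        norm_smul, Complex.norm_real, Real.norm_of_nonneg hη0]
      exact mul_le_mul_of_nonneg_left ((hyR z hz i j).trans (le_max_left _ _)) hη0
    · simpa [hT] using hηR0
  have hηR1 : N * (η * R) ≤ 1 / 2 := by nlinarith [mul_nonneg hη0 hR0]
  have hinv := fun z hz => norm_inv_entry_le hηR1 (hTone z hz)
  -- As the diagonal blocks of `T` are constant, those of `A T - T D` must vanish, which determines
  -- `D₁` and `D₂`; the off-diagonal blocks are then `η` times the Riccati equations.
  set D₁ : ℂ → Matrix m m ℂ := fun z => A₁₁ z h +
    (η : ℂ) • ((Θ z h).toBlocks₁₁ + (η : ℂ) • ((Θ z h).toBlocks₁₂ * y z)) with hD₁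
  set D₂ : ℂ → Matrix n n ℂ := fun z => A₂₂ z h +
    (η : ℂ) • ((Θ z h).toBlocks₂₂ + (η : ℂ) • ((Θ z h).toBlocks₂₁ * x z)) with hD₂
  have hTder : ∀ z ∈ slitBall ρ, ∃ T' : Matrix (m ⊕ n) (m ⊕ n) ℂ,
      (∀ i j, HasDerivAt (fun x => T x i j) (T' i j) z) ∧
      (z * (h : ℂ)) • T' = fullCoeff A₁₁ A₂₂ Θ p h z * T z -
        T z * Matrix.fromBlocks (D₁ z) 0 0 (D₂ z) := by
    intro z hz
    obtain ⟨y', hy', hyeq⟩ := hy z hz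
    obtain ⟨x', hx', hxeq⟩ := hx z hz
    refine ⟨Matrix.fromBlocks 0 ((η : ℂ) • x') ((η : ℂ) • y') 0, ?_, ?_⟩
    · rintro (i | i) (j | j)
      · simpa [hT] using hasDerivAt_const z ((1 : Matrix m m ℂ) i j)
      · simpa [hT] using (hx' i j).const_mul (η : ℂ)
      · simpa [hT] using (hy' i j).const_mul (η : ℂ)
      · simpa [hT] using hasDerivAt_const z ((1 : Matrix n n ℂ) i j)
    · have hfull : fullCoeff A₁₁ A₂₂ Θ p h z = Matrix.fromBlocks
          (A₁₁ z h + (η : ℂ) • (Θ z h).toBlocks₁₁) ((η : ℂ) • (Θ z h).toBlocks₁₂)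
          ((η : ℂ) • (Θ z h).toBlocks₂₁) (A₂₂ z h + (η : ℂ) • (Θ z h).toBlocks₂₂) := by
        rw [fullCoeff, ← hη]
        nth_rewrite 1 [← Matrix.fromBlocks_toBlocks (Θ z h)]
        rw [Matrix.fromBlocks_smul, Matrix.fromBlocks_add, zero_add, zero_add]
      rw [hfull, hT, Matrix.fromBlocks_multiply, Matrix.fromBlocks_multiply,
        Matrix.fromBlocks_smul, sub_eq_add_neg, Matrix.fromBlocks_neg, Matrix.fromBlocks_add,
        smul_comm _ (η : ℂ) x', smul_comm _ (η : ℂ) y', hyeq, hxeq, hD₁, hD₂]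
      simp only [Matrix.mul_one, Matrix.one_mul, Matrix.mul_zero, add_zero,
        zero_add, smul_zero, Matrix.mul_add, Matrix.add_mul, Matrix.smul_mul, Matrix.mul_smul,
        Matrix.mul_assoc]
      congr 1
      · module
      · module
      · module
      · module
  have dx : ∀ i j, DifferentiableOn ℂ (fun z => x z i j) (slitBall ρ) := fun i j z hz => by
    obtain ⟨x', hx', -⟩ := hx z hz
    exact (hx' i j).differentiableAt.differentiableWithinAt
  have dy : ∀ i j, DifferentiableOn ℂ (fun z => y z i j) (slitBall ρ) := fun i j z hz => by
    obtain ⟨y', hy', -⟩ := hy z hz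
    exact (hy' i j).differentiableAt.differentiableWithinAt
  refine ⟨T, ⟨fun i j => ?_, fun z hz => (hinv z hz).1, D₁, D₂, fun i j => ?_, fun i j => ?_,
    fun U hU hUΩ Z => ?_⟩, ?_, ?_, ?_, ?_⟩
  · refine DifferentiableOn.analyticOnNhd (fun z hz => ?_) (isOpen_slitBall ρ)
    obtain ⟨T', hT', -⟩ := hTder z hz
    exact (hT' i j).differentiableAt.differentiableWithinAt
  · refine DifferentiableOn.analyticOnNhd ?_ (isOpen_slitBall ρ)
    exact ((dA₁ i j).mono hΩr).add ((((dΘ _ _).mono hΩr).add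
      ((DifferentiableOn.matrix_mul_entry (fun i j => (dΘ _ _).mono hΩr) dy i j).const_smul
        (η : ℂ))).const_smul (η : ℂ))
  · refine DifferentiableOn.analyticOnNhd ?_ (isOpen_slitBall ρ)
    exact ((dA₂ i j).mono hΩr).add ((((dΘ _ _).mono hΩr).add
      ((DifferentiableOn.matrix_mul_entry (fun i j => (dΘ _ _).mono hΩr) dx i j).const_smul
        (η : ℂ))).const_smul (η : ℂ))
  · exact isSolutionOn_mulVec_iff hU (fun z hz => (hinv z (hUΩ hz)).1)
      (fun z hz => hTder z (hUΩ hz)) Z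
  · intro z hz i j
    have h1 : ‖(1 : Matrix (m ⊕ n) (m ⊕ n) ℂ) i j‖ ≤ 1 := by
      rw [Matrix.one_apply]; split_ifs <;> simp
    have h2 := norm_add_le (T z i j - (1 : Matrix (m ⊕ n) (m ⊕ n) ℂ) i j)
      ((1 : Matrix (m ⊕ n) (m ⊕ n) ℂ) i j)
    rw [sub_add_cancel] at h2
    have h3 : η * R ≤ R := mul_le_of_le_one_left hR0 (hηh.trans hh1)
    linarith [hTone z hz i j]
  · intro z hz i j
    linarith [(hinv z hz).2 i j]
  · intro z hz i j
    nlinarith [hTone z hz i j]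
  · refine continuousWithinAt_pi.2 fun i => continuousWithinAt_pi.2 fun j => ?_
    rcases i with i | i <;> rcases j with j | j
    · exact continuousWithinAt_const
    · exact (hxc i j).const_smul (η : ℂ)
    · exact (hyc i j).const_smul (η : ℂ)
    · exact continuousWithinAt_const

end
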